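/- Let $\mathbb F$ be a field of characteristic $\neq 2,3$, let $V$ be a vector space over $\mathbb F$ of dimension $3$, and let $A,B,C,\mathfrak s$ be vector spaces over $\mathbb F$. Fix a nonzero linear map $\det:\bigwedge^3V\to\mathbb F$ and let $\det:\bigwedge^3V^*\to\mathbb F$ be the map with $\det(f_1\wedge f_2\wedge f_3)\det(v_1\wedge v_2\wedge v_3)=\boldsymbol{\det}(f_i(v_j))$, where $\boldsymbol{\det}$ is the determinant of a matrix. Identify $\bigwedge^2V$ with $V^*$ by $u_1\wedge u_2\leftrightarrow\det(u_1\wedge u_2\wedge\underline{\ \ })$ and likewise $\bigwedge^2V^*$ with $V$. For $x,y\in\mathfrak{sl}(V)$ put $x\circ y=xy+yx-\frac23\mathrm{tr}(xy)I$ and $(x|y)=\frac13\mathrm{tr}(xy)$; for $u\in V$, $v^*\in V^*$ let $uv^*$ be the endomorphism $w\mapsto (v^*w)u$ and let $v^*x=v^*\circ x$. Let $$\mathcal L=(\mathfrak{sl}(V)\otimes A)\oplus(V\otimes B)\oplus(V^*\otimes C)\oplus\mathfrak s ,$$ and let bilinear maps be given: $A\times A\to A$, $(a,a')\mapsto a\circ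 a'$ (commutative) and $(a,a')\mapsto[a,a']$ (anticommutative); $A\times A\to\mathfrak s$, $(a,a')\mapsto D_{a,a'}$ (skew-symmetric); $A\times B\to B$, $(a,b)\mapsto ab$; $C\times A\to C$, $(c,a)\mapsto ca$; $T:B\times C\to A$; $B\times C\to\mathfrak s$, $(b,c)\mapsto D_{b,c}$; symmetric maps $\times:B\times B\to C$ and $\times:C\times C\to B$; maps $(d,a)\mapsto da$, $(d,b)\mapsto db$, $(d,c)\mapsto dc$ from $\mathfrak s\times A$, $\mathfrak s\times B$, $\mathfrak s\times C$ to $A$, $B$, $C$; and an anticommutative bilinear map $\mathfrak s\times\mathfrak s\to\mathcal L$, $(d,d')\mapsto[d,d']$. Define an anticommutative bilinear bracket on $\mathcal L$ by $[d,d']$ on $\mathfrak s$ and $$\begin{aligned} [x\otimes a,y\otimes a']&=[x,y]\otimes\tfrac12a\circ a'+x\circ y\otimes\tfrac12[a,a']+(x|y)D_{a,a'},\\ [x\otimes a,u\otimes b]&=xu\otimes ab,\qquad [v^*\otimes c,x\otimes a]=v^*x\otimes ca,\\ [u\otimes b,v^*\otimes c]&=\bigl(uv^*-\tfrac13(v^*u)I\bigr)\otimes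 T(b,c)+\tfrac13(v^*u)D_{b,c},\\ [u_1\otimes b_1,u_2\otimes b_2]&=(u_1\wedge u_2)\otimes(b_1\times b_2),\qquad [v_1^*\otimes c_1,v_2^*\otimes c_2]=(v_1^*\wedge v_2^*)\otimes(c_1\times c_2),\\ [d,x\otimes a]&=x\otimes da,\qquad [d,u\otimes b]=u\otimes db,\qquad [d,v^*\otimes c]=v^*\otimes dc . \end{aligned}$$ Assume that $[\mathfrak s,\mathfrak s]\subseteq\mathfrak s$, or that $A$ contains a distinguished element $1$, that is, an element with $1\circ a=2a$, $[1,a]=0$, $D_{1,a}=0$, $1b=b$, $c1=c$ and $d1=0$ for all $a\in A$, $b\in B$, $c\in C$, $d\in\mathfrak s$. Then $\mathcal L$ is a Lie algebra if and only if the following conditions hold, for all elements $a,a_i\in A$, $b,b_i\in B$, $c,c_i\in C$: (0) $\mathfrak s$ is a Lie subalgebra of $\mathcal L$ (closed under the bracket, with the Jacobi identity), $A,B,C$ are modules for $\mathfrak s$ relative to the given actions, and the maps $a\circ a'$, $[a,a']$, $D_{a,a'}$, $ab$, $ca$, $T$, $D_{b,c}$, $b_1\times b_2$, $c_1\times c_2$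 are $\mathfrak s$-invariant. (1) $A$ is an alternative algebra relative to $aa'=\frac12a\circ a'+\frac12[a,a']$, and $D_{a_1,a_2a_3}+D_{a_2,a_3a_1}+D_{a_3,a_1a_2}=0$, $D_{a_1,a_2}a_3=[[a_1,a_2],a_3]+3\bigl((a_1a_3)a_2-a_1(a_3a_2)\bigr)$. (2) $a_1(a_2b)=(a_1a_2)b$, $(ca_1)a_2=c(a_1a_2)$, $D_{a_1,a_2}b=[a_1,a_2]b$, $D_{a_1,a_2}c=c[a_2,a_1]$. (3) $aT(b,c)=T(ab,c)$, $T(b,c)a=T(b,ca)$, $D_{a,T(b,c)}=D_{ab,c}-D_{b,ca}$, $D_{b,c}a=[T(b,c),a]$. (4) $(b_1\times b_2)a=(ab_1)\times b_2=b_1\times(ab_2)$, $a(c_1\times c_2)=(c_1a)\times c_2=c_1\times(c_2a)$. (5) $D_{b,b\times b}=0$, $D_{c\times c,c}=0$, and the trilinear maps $B\times B\times B\to A$, $(b_1,b_2,b_3)\mapsto T(b_1,b_2\times b_3)$ and $C\times C\times C\to A$, $(c_1,c_2,c_3)\mapsto T(c_1\times c_2,c_3)$ are symmetric. (6) $(b_1\times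 b_2)\times c=-\frac13T(b_1,c)b_2+\frac13D_{b_1,c}b_2-T(b_2,c)b_1$ and $b\times(c_1\times c_2)=-c_2T(b,c_1)-\frac13c_1T(b,c_2)-\frac13D_{b,c_2}c_1$. -/

import Mathlib

open scoped TensorProduct

noncomputable section

namespace SlThree

/-! ### Linear algebra of a three-dimensional space -/

section VectorSpace

variable (F : Type*) [Field F] (V : Type*) [AddCommGroup V] [Module F V]

/-- `sl(V)`: the endomorphisms of trace zero. -/
abbrev Sl : Type _ := LinearMap.ker (LinearMap.trace F V)

variable {F V}

/-- For an alternating trilinear form `ω` on `W`, the bilinear map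
`(u₁, u₂) ↦ ω (u₁ ∧ u₂ ∧ _)` with values in the dual of `W`. -/
def wedgeForm {W : Type*} [AddCommGroup W] [Module F W] (ω : W [⋀^Fin 3]→ₗ[F] F) :
    W →ₗ[F] W →ₗ[F] Module.Dual F W :=
  LinearMap.mk₂ F
    (fun u₁ u₂ =>
      { toFun := fun u₃ => ω ![u₁, u₂, u₃]
        map_add' := fun x y => by
          simpa using ((ω.curryLeft u₁).curryLeft u₂).map_vecCons_add ![] x y
        map_smul' := fun c x => by
          simpa using ((ω.curryLeft u₁).curryLeft u₂).map_vecCons_smul ![] c x })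
    (fun x y u₂ => by ext u₃; exact ω.map_vecCons_add ![u₂, u₃] x y)
    (fun c x u₂ => by ext u₃; exact ω.map_vecCons_smul ![u₂, u₃] c x)
    (fun u₁ x y => by ext u₃; exact (ω.curryLeft u₁).map_vecCons_add ![u₃] x y)
    (fun c u₁ x => by ext u₃; exact (ω.curryLeft u₁).map_vecCons_smul ![u₃] c x)

theorem wedgeForm_apply {W : Type*} [AddCommGroup W] [Module F W] (ω : W [⋀^Fin 3]→ₗ[F] F)
    (u₁ u₂ u₃ : W) : wedgeForm ω u₁ u₂ u₃ = ω ![u₁, u₂, u₃] := rfl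

/-- The form `(x | y) = (1/3) tr(xy)` on `sl(V)`. -/
def slForm : Sl F V →ₗ[F] Sl F V →ₗ[F] F :=
  ((LinearMap.mul F (Module.End F V)).compl₁₂ (Submodule.subtype _) (Submodule.subtype _)).compr₂
    ((3 : F)⁻¹ • LinearMap.trace F V)

theorem slForm_apply (x y : Sl F V) :
    slForm x y = (3 : F)⁻¹ * LinearMap.trace F V (x.1 * y.1) := rfl

/-- The natural action `(x, u) ↦ x u` of `sl(V)` on `V`. -/
def slAct : Sl F V →ₗ[F] V →ₗ[F] V := Submodule.subtype _

theorem slAct_apply (x : Sl F V) (u : V) : slAct x u = x.1 u := rfl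

/-- The right action `(f, x) ↦ f x = f ∘ x` of `sl(V)` on `V*`. -/
def slActDual : Module.Dual F V →ₗ[F] Sl F V →ₗ[F] Module.Dual F V :=
  (LinearMap.llcomp F V V F).compl₁₂ LinearMap.id (Submodule.subtype _)

theorem slActDual_apply (f : Module.Dual F V) (x : Sl F V) : slActDual f x = f ∘ₗ x.1 := rfl

variable [hV : Fact (Module.finrank F V = 3)]

theorem finite_of_fact : Module.Finite F V := Module.finite_of_finrank_eq_succ hV.out

/-- The form induced on the dual space by the form `ω` on `V`. It is written through a basis and
is characterized by `dualForm_mul` below. -/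
def dualForm (ω : V [⋀^Fin 3]→ₗ[F] F) : Module.Dual F V [⋀^Fin 3]→ₗ[F] F :=
  have : Module.Finite F V := finite_of_fact
  let e : Module.Basis (Fin 3) F V := Module.finBasisOfFinrankEq F V hV.out
  (ω e)⁻¹ • (Matrix.detRowAlternating (n := Fin 3) (R := F)).compLinearMap
    (LinearMap.pi fun j => Module.Dual.eval F V (e j))

theorem dualForm_mul (ω : V [⋀^Fin 3]→ₗ[F] F) (hω : ω ≠ 0) (f : Fin 3 → Module.Dual F V)
    (v : Fin 3 → V) : dualForm ω f * ω v = (Matrix.of fun i j => f i (v j)).det := by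
  have : Module.Finite F V := finite_of_fact
  let e : Module.Basis (Fin 3) F V := Module.finBasisOfFinrankEq F V hV.out
  have he : ω e ≠ 0 := (AlternatingMap.map_basis_ne_zero_iff e ω).2 hω
  have h1 : ω v = ω e * e.det v := by
    conv_lhs => rw [ω.eq_smul_basis_det e]
    simp
  have h2 : dualForm ω f = (ω e)⁻¹ * (Matrix.of fun i j => f i (e j)).det := rfl
  have h3 : (Matrix.of fun i j => f i (v j)) =
      (Matrix.of fun i j => f i (e j)) * e.toMatrix v := by
    ext i j
    simp only [Matrix.of_apply, Matrix.mul_apply, Module.Basis.toMatrix_apply]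
    conv_lhs => rw [← e.sum_repr (v j)]
    simp only [map_sum, map_smul, smul_eq_mul]
    exact Finset.sum_congr rfl fun _ _ => mul_comm _ _
  rw [h1, h2, h3, Matrix.det_mul, Module.Basis.det_apply]
  field_simp

/-- The identification of `⋀² V*` with `V`: `f₁ ∧ f₂` is the vector `w` such that
`f₃ w = dualForm ω (f₁ ∧ f₂ ∧ f₃)` for all `f₃`. -/
def wedgeDual (ω : V [⋀^Fin 3]→ₗ[F] F) : Module.Dual F V →ₗ[F] Module.Dual F V →ₗ[F] V :=
  have : Module.Finite F V := finite_of_fact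
  (wedgeForm (dualForm ω)).compr₂ (Module.evalEquiv F V).symm.toLinearMap

theorem apply_wedgeDual (ω : V [⋀^Fin 3]→ₗ[F] F) (f₁ f₂ f₃ : Module.Dual F V) :
    f₃ (wedgeDual ω f₁ f₂) = dualForm ω ![f₁, f₂, f₃] := by
  have : Module.Finite F V := finite_of_fact
  have h := LinearEquiv.apply_symm_apply (Module.evalEquiv F V) (wedgeForm (dualForm ω) f₁ f₂)
  exact congrArg (fun g : Module.Dual F (Module.Dual F V) => g f₃) h

variable [h3 : NeZero (3 : F)]

/-- The traceless part `f - (1/3) tr(f) I` of an endomorphism. -/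
def traceless : Module.End F V →ₗ[F] Sl F V :=
  LinearMap.codRestrict _
    (LinearMap.id - (LinearMap.trace F V).smulRight ((3 : F)⁻¹ • (1 : Module.End F V)))
    (fun f => by
      have : Module.Finite F V := finite_of_fact
      have h : (3 : F) ≠ 0 := h3.out
      simp [LinearMap.mem_ker, LinearMap.trace_one, hV.out, h])

theorem coe_traceless (f : Module.End F V) :
    (traceless f : Module.End F V) = f - ((3 : F)⁻¹ * LinearMap.trace F V f) • 1 := by
  change f - LinearMap.trace F V f • ((3 : F)⁻¹ • (1 : Module.End F V)) = _
  rw [smul_smul, mul_comm]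

/-- The commutator `xy - yx` on `sl(V)`. -/
def slBracket : Sl F V →ₗ[F] Sl F V →ₗ[F] Sl F V :=
  ((LinearMap.mul F (Module.End F V) - (LinearMap.mul F (Module.End F V)).flip).compl₁₂
    (Submodule.subtype _) (Submodule.subtype _)).compr₂ traceless

theorem coe_slBracket (x y : Sl F V) :
    (slBracket x y : Module.End F V) = x.1 * y.1 - y.1 * x.1 := by
  have : Module.Finite F V := finite_of_fact
  simp [slBracket, coe_traceless, LinearMap.trace_mul_comm F x.1 y.1]

/-- The product `x ∘ y = xy + yx - (2/3) tr(xy) I` on `sl(V)`. -/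
def slCirc : Sl F V →ₗ[F] Sl F V →ₗ[F] Sl F V :=
  ((LinearMap.mul F (Module.End F V) + (LinearMap.mul F (Module.End F V)).flip).compl₁₂
    (Submodule.subtype _) (Submodule.subtype _)).compr₂ traceless

theorem coe_slCirc (x y : Sl F V) :
    (slCirc x y : Module.End F V) =
      x.1 * y.1 + y.1 * x.1 - (2 / 3 * LinearMap.trace F V (x.1 * y.1)) • 1 := by
  have : Module.Finite F V := finite_of_fact
  have h : (3 : F)⁻¹ * (LinearMap.trace F V (x.1 * y.1) + LinearMap.trace F V (x.1 * y.1)) =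
      2 / 3 * LinearMap.trace F V (x.1 * y.1) := by ring
  rw [← h]
  simp only [slCirc, LinearMap.compr₂_apply, LinearMap.compl₁₂_apply, Submodule.subtype_apply,
    LinearMap.add_apply, LinearMap.mul_apply', LinearMap.flip_apply]
  rw [coe_traceless, map_add, LinearMap.trace_mul_comm F y.1 x.1]

/-- The map `(u, f) ↦ u f - (1/3) f(u) I` from `V × V*` to `sl(V)`, where `u f` is the endomorphism
`w ↦ f(w) u`. -/
def rankOne : V →ₗ[F] Module.Dual F V →ₗ[F] Sl F V :=
  (LinearMap.smulRightₗ (R := F) (M := V) (M₂ := V)).flip.compr₂ traceless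

theorem coe_rankOne (u : V) (f : Module.Dual F V) :
    (rankOne u f : Module.End F V) = f.smulRight u - ((3 : F)⁻¹ * f u) • 1 := by
  have : Module.Finite F V := finite_of_fact
  simp [rankOne, coe_traceless]

end VectorSpace

/-! ### The space and its bracket -/

section Bracket

variable (F : Type*) [Field F] (V : Type*) [AddCommGroup V] [Module F V]
  (A : Type*) [AddCommGroup A] [Module F A] (B : Type*) [AddCommGroup B] [Module F B]
  (C : Type*) [AddCommGroup C] [Module F C] (S : Type*) [AddCommGroup S] [Module F S]

/-- The vector space `(sl(V) ⊗ A) ⊕ (V ⊗ B) ⊕ (V* ⊗ C) ⊕ S`. -/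
def Total : Type _ := (Sl F V ⊗[F] A) × (V ⊗[F] B) × (Module.Dual F V ⊗[F] C) × S

instance : AddCommGroup (Total F V A B C S) :=
  inferInstanceAs (AddCommGroup ((Sl F V ⊗[F] A) × (V ⊗[F] B) × (Module.Dual F V ⊗[F] C) × S))

instance : Module F (Total F V A B C S) :=
  inferInstanceAs (Module F ((Sl F V ⊗[F] A) × (V ⊗[F] B) × (Module.Dual F V ⊗[F] C) × S))

/-- The inclusion of `sl(V) ⊗ A`. -/
def inA : Sl F V ⊗[F] A →ₗ[F] Total F V A B C S := LinearMap.inl F _ _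

/-- The inclusion of `V ⊗ B`. -/
def inB : V ⊗[F] B →ₗ[F] Total F V A B C S := LinearMap.inr F _ _ ∘ₗ LinearMap.inl F _ _

/-- The inclusion of `V* ⊗ C`. -/
def inC : Module.Dual F V ⊗[F] C →ₗ[F] Total F V A B C S :=
  LinearMap.inr F _ _ ∘ₗ LinearMap.inr F _ _ ∘ₗ LinearMap.inl F _ _

/-- The inclusion of `S`. -/
def inS : S →ₗ[F] Total F V A B C S :=
  LinearMap.inr F _ _ ∘ₗ LinearMap.inr F _ _ ∘ₗ LinearMap.inr F _ _

/-- The projection onto `sl(V) ⊗ A`. -/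
def prA : Total F V A B C S →ₗ[F] Sl F V ⊗[F] A := LinearMap.fst F _ _

/-- The projection onto `V ⊗ B`. -/
def prB : Total F V A B C S →ₗ[F] V ⊗[F] B := LinearMap.fst F _ _ ∘ₗ LinearMap.snd F _ _

/-- The projection onto `V* ⊗ C`. -/
def prC : Total F V A B C S →ₗ[F] Module.Dual F V ⊗[F] C :=
  LinearMap.fst F _ _ ∘ₗ LinearMap.snd F _ _ ∘ₗ LinearMap.snd F _ _

/-- The projection onto `S`. -/
def prS : Total F V A B C S →ₗ[F] S :=
  LinearMap.snd F _ _ ∘ₗ LinearMap.snd F _ _ ∘ₗ LinearMap.snd F _ _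

@[simp] theorem prA_inA (z : Sl F V ⊗[F] A) :
    prA F V A B C S (inA F V A B C S z) = z := rfl

@[simp] theorem prA_inB (z : V ⊗[F] B) :
    prA F V A B C S (inB F V A B C S z) = 0 := rfl

@[simp] theorem prA_inC (z : Module.Dual F V ⊗[F] C) :
    prA F V A B C S (inC F V A B C S z) = 0 := rfl

@[simp] theorem prA_inS (z : S) :
    prA F V A B C S (inS F V A B C S z) = 0 := rfl

@[simp] theorem prB_inA (z : Sl F V ⊗[F] A) :
    prB F V A B C S (inA F V A B C S z) = 0 := rfl

@[simp] theorem prB_inB (z : V ⊗[F] B) :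
    prB F V A B C S (inB F V A B C S z) = z := rfl

@[simp] theorem prB_inC (z : Module.Dual F V ⊗[F] C) :
    prB F V A B C S (inC F V A B C S z) = 0 := rfl

@[simp] theorem prB_inS (z : S) :
    prB F V A B C S (inS F V A B C S z) = 0 := rfl

@[simp] theorem prC_inA (z : Sl F V ⊗[F] A) :
    prC F V A B C S (inA F V A B C S z) = 0 := rfl

@[simp] theorem prC_inB (z : V ⊗[F] B) :
    prC F V A B C S (inB F V A B C S z) = 0 := rfl

@[simp] theorem prC_inC (z : Module.Dual F V ⊗[F] C) :
    prC F V A B C S (inC F V A B C S z) = z := rfl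

@[simp] theorem prC_inS (z : S) :
    prC F V A B C S (inS F V A B C S z) = 0 := rfl

@[simp] theorem prS_inA (z : Sl F V ⊗[F] A) :
    prS F V A B C S (inA F V A B C S z) = 0 := rfl

@[simp] theorem prS_inB (z : V ⊗[F] B) :
    prS F V A B C S (inB F V A B C S z) = 0 := rfl

@[simp] theorem prS_inC (z : Module.Dual F V ⊗[F] C) :
    prS F V A B C S (inC F V A B C S z) = 0 := rfl

@[simp] theorem prS_inS (z : S) :
    prS F V A B C S (inS F V A B C S z) = z := rfl

/-- The bilinear maps that define the bracket. Nothing but bilinearity and the stated symmetries is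
required; in particular the three actions of `S` are only bilinear maps. The bracket of two
elements of `S` may be any element of the whole space. -/
structure BracketData where
  /-- `a ∘ a'` -/
  circ : A →ₗ[F] A →ₗ[F] A
  circ_comm : ∀ a a', circ a a' = circ a' a
  /-- `[a, a']` -/
  comm : A →ₗ[F] A →ₗ[F] A
  comm_anti : ∀ a a', comm a a' = -comm a' a
  /-- `D_{a, a'}` -/
  dA : A →ₗ[F] A →ₗ[F] S
  dA_skew : ∀ a a', dA a a' = -dA a' a
  /-- `ab` -/
  actB : A →ₗ[F] B →ₗ[F] B
  /-- `ca` -/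
  actC : C →ₗ[F] A →ₗ[F] C
  /-- `T(b, c)` -/
  t : B →ₗ[F] C →ₗ[F] A
  /-- `D_{b, c}` -/
  dBC : B →ₗ[F] C →ₗ[F] S
  /-- `b₁ × b₂` -/
  crossB : B →ₗ[F] B →ₗ[F] C
  crossB_symm : ∀ b₁ b₂, crossB b₁ b₂ = crossB b₂ b₁
  /-- `c₁ × c₂` -/
  crossC : C →ₗ[F] C →ₗ[F] B
  crossC_symm : ∀ c₁ c₂, crossC c₁ c₂ = crossC c₂ c₁
  /-- `da` -/
  sA : S →ₗ[F] A →ₗ[F] A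
  /-- `db` -/
  sB : S →ₗ[F] B →ₗ[F] B
  /-- `dc` -/
  sC : S →ₗ[F] C →ₗ[F] C
  /-- `[d, d']` -/
  sS : S →ₗ[F] S →ₗ[F] Total F V A B C S
  sS_anti : ∀ d d', sS d d' = -sS d' d

namespace BracketData

variable {F V A B C S}
variable (D : BracketData F V A B C S)

/-- The bilinear map `(x ⊗ a, y ⊗ a') ↦ g(x, y) h(a, a')` for a scalar-valued `g`. -/
def scalarTensor {M N P Q R : Type*} [AddCommGroup M] [Module F M] [AddCommGroup N] [Module F N]
    [AddCommGroup P] [Module F P] [AddCommGroup Q] [Module F Q] [AddCommGroup R] [Module F R]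
    (g : M →ₗ[F] N →ₗ[F] F) (h : P →ₗ[F] Q →ₗ[F] R) : M ⊗[F] P →ₗ[F] N ⊗[F] Q →ₗ[F] R :=
  (TensorProduct.map₂ g h).compr₂ (TensorProduct.lid F R).toLinearMap

section

variable [Fact (Module.finrank F V = 3)] [NeZero (3 : F)]

/-- `[x ⊗ a, y ⊗ a'] = [x, y] ⊗ (1/2) a ∘ a' + (x ∘ y) ⊗ (1/2) [a, a'] + (x | y) D_{a, a'}` -/
def brAA : Sl F V ⊗[F] A →ₗ[F] Sl F V ⊗[F] A →ₗ[F] Total F V A B C S :=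
  (TensorProduct.map₂ slBracket ((2 : F)⁻¹ • D.circ)).compr₂ (inA F V A B C S)
    + (TensorProduct.map₂ slCirc ((2 : F)⁻¹ • D.comm)).compr₂ (inA F V A B C S)
    + (scalarTensor slForm D.dA).compr₂ (inS F V A B C S)

/-- `[u ⊗ b, f ⊗ c] = (u f - (1/3) f(u) I) ⊗ T(b, c) + (1/3) f(u) D_{b, c}` -/
def brBC : V ⊗[F] B →ₗ[F] Module.Dual F V ⊗[F] C →ₗ[F] Total F V A B C S :=
  (TensorProduct.map₂ rankOne D.t).compr₂ (inA F V A B C S)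
    + (scalarTensor ((3 : F)⁻¹ • Module.Dual.eval F V) D.dBC).compr₂ (inS F V A B C S)

/-- `[f₁ ⊗ c₁, f₂ ⊗ c₂] = (f₁ ∧ f₂) ⊗ (c₁ × c₂)` -/
def brCC (vol : V [⋀^Fin 3]→ₗ[F] F) :
    Module.Dual F V ⊗[F] C →ₗ[F] Module.Dual F V ⊗[F] C →ₗ[F] Total F V A B C S :=
  (TensorProduct.map₂ (wedgeDual vol) D.crossC).compr₂ (inB F V A B C S)

end

/-- `[u₁ ⊗ b₁, u₂ ⊗ b₂] = (u₁ ∧ u₂) ⊗ (b₁ × b₂)` -/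
def brBB (vol : V [⋀^Fin 3]→ₗ[F] F) :
    V ⊗[F] B →ₗ[F] V ⊗[F] B →ₗ[F] Total F V A B C S :=
  (TensorProduct.map₂ (wedgeForm vol) D.crossB).compr₂ (inC F V A B C S)

/-- `[x ⊗ a, u ⊗ b] = x u ⊗ a b` -/
def brAB : Sl F V ⊗[F] A →ₗ[F] V ⊗[F] B →ₗ[F] Total F V A B C S :=
  (TensorProduct.map₂ slAct D.actB).compr₂ (inB F V A B C S)

/-- `[f ⊗ c, x ⊗ a] = f x ⊗ c a` -/
def brCA : Module.Dual F V ⊗[F] C →ₗ[F] Sl F V ⊗[F] A →ₗ[F] Total F V A B C S :=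
  (TensorProduct.map₂ slActDual D.actC).compr₂ (inC F V A B C S)

/-- `[d, x ⊗ a] = x ⊗ d a` -/
def brSA : S →ₗ[F] Sl F V ⊗[F] A →ₗ[F] Total F V A B C S :=
  (LinearMap.lTensorHom (Sl F V) ∘ₗ D.sA).compr₂ (inA F V A B C S)

/-- `[d, u ⊗ b] = u ⊗ d b` -/
def brSB : S →ₗ[F] V ⊗[F] B →ₗ[F] Total F V A B C S :=
  (LinearMap.lTensorHom V ∘ₗ D.sB).compr₂ (inB F V A B C S)

/-- `[d, f ⊗ c] = f ⊗ d c` -/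
def brSC : S →ₗ[F] Module.Dual F V ⊗[F] C →ₗ[F] Total F V A B C S :=
  (LinearMap.lTensorHom (Module.Dual F V) ∘ₗ D.sC).compr₂ (inC F V A B C S)

/-- The bracket on the whole space: the anticommutative bilinear map that is given on the summands
by the maps above. -/
def bracket [Fact (Module.finrank F V = 3)] [NeZero (3 : F)] (vol : V [⋀^Fin 3]→ₗ[F] F) :
    Total F V A B C S →ₗ[F] Total F V A B C S →ₗ[F] Total F V A B C S :=
  let pA := prA F V A B C S
  let pB := prB F V A B C S
  let pC := prC F V A B C S
  let pS := prS F V A B C S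
  let mixed : Total F V A B C S →ₗ[F] Total F V A B C S →ₗ[F] Total F V A B C S :=
    D.brAB.compl₁₂ pA pB + D.brCA.compl₁₂ pC pA + D.brBC.compl₁₂ pB pC
      + D.brSA.compl₁₂ pS pA + D.brSB.compl₁₂ pS pB + D.brSC.compl₁₂ pS pC
  D.brAA.compl₁₂ pA pA + (D.brBB vol).compl₁₂ pB pB + (D.brCC vol).compl₁₂ pC pC
    + D.sS.compl₁₂ pS pS + (mixed - mixed.flip)

/-! The bracket of the generators. -/

section

variable [Fact (Module.finrank F V = 3)] [NeZero (3 : F)] (vol : V [⋀^Fin 3]→ₗ[F] F)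

theorem bracket_A_A (x y : Sl F V) (a a' : A) :
    D.bracket vol (inA F V A B C S (x ⊗ₜ a)) (inA F V A B C S (y ⊗ₜ a')) =
      inA F V A B C S (slBracket x y ⊗ₜ ((2 : F)⁻¹ • D.circ a a'))
        + inA F V A B C S (slCirc x y ⊗ₜ ((2 : F)⁻¹ • D.comm a a'))
        + inS F V A B C S (slForm x y • D.dA a a') := by
  simp [bracket, brAA, scalarTensor]

theorem bracket_A_B (x : Sl F V) (u : V) (a : A) (b : B) :
    D.bracket vol (inA F V A B C S (x ⊗ₜ a)) (inB F V A B C S (u ⊗ₜ b)) =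
      inB F V A B C S (x.1 u ⊗ₜ D.actB a b) := by
  simp [bracket, brAB, slAct_apply]

theorem bracket_C_A (f : Module.Dual F V) (x : Sl F V) (c : C) (a : A) :
    D.bracket vol (inC F V A B C S (f ⊗ₜ c)) (inA F V A B C S (x ⊗ₜ a)) =
      inC F V A B C S ((f ∘ₗ x.1) ⊗ₜ D.actC c a) := by
  simp [bracket, brCA, slActDual_apply]

theorem bracket_B_C (u : V) (f : Module.Dual F V) (b : B) (c : C) :
    D.bracket vol (inB F V A B C S (u ⊗ₜ b)) (inC F V A B C S (f ⊗ₜ c)) =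
      inA F V A B C S (rankOne u f ⊗ₜ D.t b c)
        + inS F V A B C S (((3 : F)⁻¹ * f u) • D.dBC b c) := by
  simp [bracket, brBC, scalarTensor]

theorem bracket_B_B (u₁ u₂ : V) (b₁ b₂ : B) :
    D.bracket vol (inB F V A B C S (u₁ ⊗ₜ b₁)) (inB F V A B C S (u₂ ⊗ₜ b₂)) =
      inC F V A B C S (wedgeForm vol u₁ u₂ ⊗ₜ D.crossB b₁ b₂) := by
  simp [bracket, brBB]

theorem bracket_C_C (f₁ f₂ : Module.Dual F V) (c₁ c₂ : C) :
    D.bracket vol (inC F V A B C S (f₁ ⊗ₜ c₁)) (inC F V A B C S (f₂ ⊗ₜ c₂)) =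
      inB F V A B C S (wedgeDual vol f₁ f₂ ⊗ₜ D.crossC c₁ c₂) := by
  simp [bracket, brCC]

theorem bracket_S_A (d : S) (x : Sl F V) (a : A) :
    D.bracket vol (inS F V A B C S d) (inA F V A B C S (x ⊗ₜ a)) =
      inA F V A B C S (x ⊗ₜ D.sA d a) := by
  simp [bracket, brSA]

theorem bracket_S_B (d : S) (u : V) (b : B) :
    D.bracket vol (inS F V A B C S d) (inB F V A B C S (u ⊗ₜ b)) =
      inB F V A B C S (u ⊗ₜ D.sB d b) := by
  simp [bracket, brSB]

theorem bracket_S_C (d : S) (f : Module.Dual F V) (c : C) :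
    D.bracket vol (inS F V A B C S d) (inC F V A B C S (f ⊗ₜ c)) =
      inC F V A B C S (f ⊗ₜ D.sC d c) := by
  simp [bracket, brSC]

theorem bracket_S_S (d d' : S) :
    D.bracket vol (inS F V A B C S d) (inS F V A B C S d') = D.sS d d' := by
  simp [bracket]

end

/-- The bracket on `S` induced by the bracket of the whole space (its component in `S`). -/
def brS : S →ₗ[F] S →ₗ[F] S := D.sS.compr₂ (prS F V A B C S)

/-- `S` is closed under the bracket of the whole space. -/
def SClosed : Prop := ∀ d d', D.sS d d' ∈ LinearMap.range (inS F V A B C S)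

/-- `e` is a distinguished element of `A`: then `x ⊗ e` acts on each summand as `x` does, and it
is annihilated by `S`. -/
structure IsDistinguished (e : A) : Prop where
  circ : ∀ a, D.circ e a = (2 : F) • a
  comm : ∀ a, D.comm e a = 0
  dA : ∀ a, D.dA e a = 0
  actB : ∀ b, D.actB e b = b
  actC : ∀ c, D.actC c e = c
  sA : ∀ d, D.sA d e = 0

/-- The product `a a' = (1/2) a ∘ a' + (1/2) [a, a']` on `A`. -/
def mulA : A →ₗ[F] A →ₗ[F] A := (2 : F)⁻¹ • D.circ + (2 : F)⁻¹ • D.comm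

/-- `S` is a Lie subalgebra, `A`, `B`, `C` are `S`-modules, and the bilinear maps are
`S`-invariant. -/
structure Cond0 : Prop where
  closed : D.SClosed
  jacobi : ∀ d₁ d₂ d₃,
    D.brS (D.brS d₁ d₂) d₃ + D.brS (D.brS d₂ d₃) d₁ + D.brS (D.brS d₃ d₁) d₂ = 0
  moduleA : ∀ d d' a, D.sA (D.brS d d') a = D.sA d (D.sA d' a) - D.sA d' (D.sA d a)
  moduleB : ∀ d d' b, D.sB (D.brS d d') b = D.sB d (D.sB d' b) - D.sB d' (D.sB d b)
  moduleC : ∀ d d' c, D.sC (D.brS d d') c = D.sC d (D.sC d' c) - D.sC d' (D.sC d c)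
  inv_circ : ∀ d a a', D.sA d (D.circ a a') = D.circ (D.sA d a) a' + D.circ a (D.sA d a')
  inv_comm : ∀ d a a', D.sA d (D.comm a a') = D.comm (D.sA d a) a' + D.comm a (D.sA d a')
  inv_dA : ∀ d a a', D.brS d (D.dA a a') = D.dA (D.sA d a) a' + D.dA a (D.sA d a')
  inv_actB : ∀ d a b, D.sB d (D.actB a b) = D.actB (D.sA d a) b + D.actB a (D.sB d b)
  inv_actC : ∀ d c a, D.sC d (D.actC c a) = D.actC (D.sC d c) a + D.actC c (D.sA d a)
  inv_t : ∀ d b c, D.sA d (D.t b c) = D.t (D.sB d b) c + D.t b (D.sC d c)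
  inv_dBC : ∀ d b c, D.brS d (D.dBC b c) = D.dBC (D.sB d b) c + D.dBC b (D.sC d c)
  inv_crossB : ∀ d b₁ b₂,
    D.sC d (D.crossB b₁ b₂) = D.crossB (D.sB d b₁) b₂ + D.crossB b₁ (D.sB d b₂)
  inv_crossC : ∀ d c₁ c₂,
    D.sB d (D.crossC c₁ c₂) = D.crossC (D.sC d c₁) c₂ + D.crossC c₁ (D.sC d c₂)

/-- `A` is alternative, with two conditions on `D_{a, a'}`. -/
structure Cond1 : Prop where
  left_alternative : ∀ a b, D.mulA (D.mulA a a) b = D.mulA a (D.mulA a b)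
  right_alternative : ∀ a b, D.mulA (D.mulA b a) a = D.mulA b (D.mulA a a)
  dA_cyclic : ∀ a₁ a₂ a₃,
    D.dA a₁ (D.mulA a₂ a₃) + D.dA a₂ (D.mulA a₃ a₁) + D.dA a₃ (D.mulA a₁ a₂) = 0
  dA_apply : ∀ a₁ a₂ a₃, D.sA (D.dA a₁ a₂) a₃ = D.comm (D.comm a₁ a₂) a₃
    + (3 : F) • (D.mulA (D.mulA a₁ a₃) a₂ - D.mulA a₁ (D.mulA a₃ a₂))

/-- `B` and `C` are associative modules for `A`, with the action of `D_{a, a'}` on them. -/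
structure Cond2 : Prop where
  assocB : ∀ a₁ a₂ b, D.actB a₁ (D.actB a₂ b) = D.actB (D.mulA a₁ a₂) b
  assocC : ∀ c a₁ a₂, D.actC (D.actC c a₁) a₂ = D.actC c (D.mulA a₁ a₂)
  dA_B : ∀ a₁ a₂ b, D.sB (D.dA a₁ a₂) b = D.actB (D.comm a₁ a₂) b
  dA_C : ∀ a₁ a₂ c, D.sC (D.dA a₁ a₂) c = D.actC c (D.comm a₂ a₁)

/-- The conditions that link `T`, `D` and the product of `A`. -/
structure Cond3 : Prop where
  t_left : ∀ a b c, D.mulA a (D.t b c) = D.t (D.actB a b) c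
  t_right : ∀ a b c, D.mulA (D.t b c) a = D.t b (D.actC c a)
  dA_t : ∀ a b c, D.dA a (D.t b c) = D.dBC (D.actB a b) c - D.dBC b (D.actC c a)
  dBC_apply : ∀ a b c, D.sA (D.dBC b c) a = D.comm (D.t b c) a

/-- The conditions that link the symmetric products and the actions of `A`. -/
structure Cond4 : Prop where
  crossB_left : ∀ a b₁ b₂, D.actC (D.crossB b₁ b₂) a = D.crossB (D.actB a b₁) b₂
  crossB_right : ∀ a b₁ b₂, D.actC (D.crossB b₁ b₂) a = D.crossB b₁ (D.actB a b₂)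
  crossC_left : ∀ a c₁ c₂, D.actB a (D.crossC c₁ c₂) = D.crossC (D.actC c₁ a) c₂
  crossC_right : ∀ a c₁ c₂, D.actB a (D.crossC c₁ c₂) = D.crossC c₁ (D.actC c₂ a)

/-- `D_{b, b × b} = 0`, `D_{c × c, c} = 0`, and the maps `T(b₁, b₂ × b₃)` and `T(c₁ × c₂, c₃)`
are symmetric, that is, invariant under the two adjacent transpositions of the arguments. -/
structure Cond5 : Prop where
  dB : ∀ b, D.dBC b (D.crossB b b) = 0
  dC : ∀ c, D.dBC (D.crossC c c) c = 0
  tB_swap₁₂ : ∀ b₁ b₂ b₃, D.t b₁ (D.crossB b₂ b₃) = D.t b₂ (D.crossB b₁ b₃)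
  tB_swap₂₃ : ∀ b₁ b₂ b₃, D.t b₁ (D.crossB b₂ b₃) = D.t b₁ (D.crossB b₃ b₂)
  tC_swap₁₂ : ∀ c₁ c₂ c₃, D.t (D.crossC c₁ c₂) c₃ = D.t (D.crossC c₂ c₁) c₃
  tC_swap₂₃ : ∀ c₁ c₂ c₃, D.t (D.crossC c₁ c₂) c₃ = D.t (D.crossC c₁ c₃) c₂

/-- The formulas for `(b₁ × b₂) × c` and `b × (c₁ × c₂)`. -/
structure Cond6 : Prop where
  crossB_cross : ∀ b₁ b₂ c, D.crossC (D.crossB b₁ b₂) c =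
    -((1 / 3 : F) • D.actB (D.t b₁ c) b₂) + (1 / 3 : F) • D.sB (D.dBC b₁ c) b₂
      - D.actB (D.t b₂ c) b₁
  cross_crossC : ∀ b c₁ c₂, D.crossB b (D.crossC c₁ c₂) =
    -D.actC c₂ (D.t b c₁) - (1 / 3 : F) • D.actC c₁ (D.t b c₂)
      - (1 / 3 : F) • D.sC (D.dBC b c₂) c₁

end BracketData

/-- A bilinear map makes the vector space `L` a Lie algebra. -/
structure IsLieBracket {F L : Type*} [Field F] [AddCommGroup L] [Module F L]
    (br : L →ₗ[F] L →ₗ[F] L) : Prop where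
  alternating : ∀ x, br x x = 0
  jacobi : ∀ x y z, br (br x y) z + br (br y z) x + br (br z x) y = 0

end Bracket

end SlThree

/-! The bracket is anticommutative by construction, so everything rests on the cyclic sum
`jacobiator` of pure tensors from the four summands. It is trilinear and changes at most by a sign
under permutations, hence twenty types of triples suffice (`jacobiator_eq_zero_of_sorted`). For each
type it expands into terms (expression in `sl(V)`, `V`, `V*`) ⊗ (expression in `A`, `B`, `C`), plus
scalar multiples of elements of `S`. The type AAA gives `Cond1`, AAB and AAC give `Cond2`, ABC gives
`Cond3`, ABB and ACC give `Cond4`, BBB and CCC give `Cond5`, BBC and BCC give `Cond6`, and the types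
with an entry from `S` give `Cond0`.

From the conditions to Jacobi: either every second factor vanishes, or the second factors agree up
to known scalars and the first factors cancel by an identity of three-dimensional linear algebra.
For ABB and ACC the identity says that a traceless endomorphism annihilates the volume form. For BBB
and CCC it is the traceless part of Cramer's rule. For AAA it is the polarized Cayley–Hamilton
identity `sum_perm_mul`: alternativity makes the six associators equal up to sign, and the 3 in the
formula for `D_{a,b} c` is the 3 in `tr(xy) = 3 (x | y)`.

From Jacobi to the conditions: at suitable matrix units, basis vectors and dual basis vectors nearly
all terms vanish, and a coordinate functional on the first tensor factor (`coefA`, `coefB`, `coefC`)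
or the projection to `S` isolates the wanted equation.

Closure of `S`, when not assumed, comes from the distinguished element `1`: by the Jacobi identity
`sl(V) ⊗ 1` annihilates `[d, d']`, while `sl(V)`, `V` and `V*` contain no nonzero vector annihilated
by `sl(V)`, so `[d, d']` has only a component in `S` (`IsDistinguished.sClosed`). -/

namespace SlThree

/-! ### Slices of tensors -/

section Slice

variable {F M N : Type*} [Field F] [AddCommGroup M] [Module F M] [AddCommGroup N] [Module F N]

/-- The map `m ⊗ n ↦ φ(m) n`. -/
def slice (φ : Module.Dual F M) : M ⊗[F] N →ₗ[F] N :=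
  (TensorProduct.lid F N).toLinearMap ∘ₗ LinearMap.rTensor N φ

@[simp] theorem slice_tmul (φ : Module.Dual F M) (m : M) (n : N) :
    slice φ (m ⊗ₜ[F] n) = φ m • n := by
  simp [slice]

theorem map_tmul_neg {P Q R : Type*} [AddCommMonoid P] [Module F P] [AddCommGroup Q] [Module F Q]
    [AddCommGroup R] [Module F R] (f : P ⊗[F] Q →ₗ[F] R) (p : P) (q : Q) :
    f (p ⊗ₜ (-q)) = -f (p ⊗ₜ q) :=
  (f ∘ₗ TensorProduct.mk F P Q p).map_neg q

theorem map_neg_tmul {P Q R : Type*} [AddCommGroup P] [Module F P] [AddCommMonoid Q] [Module F Q]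
    [AddCommGroup R] [Module F R] (f : P ⊗[F] Q →ₗ[F] R) (p : P) (q : Q) :
    f ((-p) ⊗ₜ q) = -f (p ⊗ₜ q) :=
  (f ∘ₗ (TensorProduct.mk F P Q).flip q).map_neg p

end Slice

/-! ### The cyclic sum of a bilinear map -/

section Cyclic

variable {F L : Type*} [Field F] [AddCommGroup L] [Module F L] (br : L →ₗ[F] L →ₗ[F] L)

/-- The sum `[[x, y], z] + [[y, z], x] + [[z, x], y]`. -/
def jacobiator (x y z : L) : L := br (br x y) z + br (br y z) x + br (br z x) y

theorem jacobiator_rotate (x y z : L) : jacobiator br x y z = jacobiator br y z x := by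
  simp only [jacobiator]; abel

theorem jacobiator_swap (h : ∀ x y, br x y = -br y x) (x y z : L) :
    jacobiator br x y z = -jacobiator br y x z := by
  simp only [jacobiator]
  rw [h x y, h y z, h z x]
  simp only [map_neg, LinearMap.neg_apply]
  abel

theorem jacobiator_eq_zero_of_mem_span {G : Set L} (hG : Submodule.span F G = ⊤)
    (h : ∀ x ∈ G, ∀ y ∈ G, ∀ z ∈ G, jacobiator br x y z = 0) (x y z : L) :
    jacobiator br x y z = 0 := by
  have hmem : ∀ x : L, x ∈ Submodule.span F G := fun x => hG ▸ Submodule.mem_top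
  induction hmem x using Submodule.span_induction with
  | zero => simp [jacobiator]
  | add x x' _ _ hx hx' =>
    have : jacobiator br (x + x') y z = jacobiator br x y z + jacobiator br x' y z := by
      simp only [jacobiator, map_add, LinearMap.add_apply]; abel
    rw [this, hx, hx', add_zero]
  | smul c x _ hx =>
    have : jacobiator br (c • x) y z = c • jacobiator br x y z := by
      simp only [jacobiator, map_smul, LinearMap.smul_apply, smul_add]
    rw [this, hx, smul_zero]
  | mem x hx =>
  induction hmem y using Submodule.span_induction with
  | zero => simp [jacobiator]
  | add y y' _ _ hy hy' =>
    have : jacobiator br x (y + y') z = jacobiator br x y z + jacobiator br x y' z := by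
      simp only [jacobiator, map_add, LinearMap.add_apply]; abel
    rw [this, hy, hy', add_zero]
  | smul c y _ hy =>
    have : jacobiator br x (c • y) z = c • jacobiator br x y z := by
      simp only [jacobiator, map_smul, LinearMap.smul_apply, smul_add]
    rw [this, hy, smul_zero]
  | mem y hy =>
  induction hmem z using Submodule.span_induction with
  | zero => simp [jacobiator]
  | add z z' _ _ hz hz' =>
    have : jacobiator br x y (z + z') = jacobiator br x y z + jacobiator br x y z' := by
      simp only [jacobiator, map_add, LinearMap.add_apply]; abel
    rw [this, hz, hz', add_zero]
  | smul c z _ hz =>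
    have : jacobiator br x y (c • z) = c • jacobiator br x y z := by
      simp only [jacobiator, map_smul, LinearMap.smul_apply, smul_add]
    rw [this, hz, smul_zero]
  | mem z hz => exact h x hx y hy z hz

/-- Rotation and one swap generate all permutations of the arguments, so every triple of generators
can be sorted by index at the cost of a sign. -/
theorem jacobiator_eq_zero_of_sorted {G : Fin 4 → Set L}
    (hG : Submodule.span F (⋃ i, G i) = ⊤) (hanti : ∀ x y, br x y = -br y x)
    (h : ∀ i j k, i ≤ j → j ≤ k → ∀ x ∈ G i, ∀ y ∈ G j, ∀ z ∈ G k, jacobiator br x y z = 0)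
    (x y z : L) : jacobiator br x y z = 0 := by
  refine jacobiator_eq_zero_of_mem_span br hG ?_ x y z
  intro x hx y hy z hz
  obtain ⟨i, hx⟩ := Set.mem_iUnion.1 hx
  obtain ⟨j, hy⟩ := Set.mem_iUnion.1 hy
  obtain ⟨k, hz⟩ := Set.mem_iUnion.1 hz
  have rot := jacobiator_rotate br
  have swap := jacobiator_swap br hanti
  rcases le_total i j with hij | hij <;> rcases le_total j k with hjk | hjk <;>
    rcases le_total i k with hik | hik
  · exact h i j k hij hjk x hx y hy z hz
  · exact h i j k hij hjk x hx y hy z hz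
  · rw [rot, rot, swap, h i k j hik hjk x hx z hz y hy, neg_zero]
  · rw [rot, rot, h k i j hik hij z hz x hx y hy]
  · rw [swap, h j i k hij hik y hy x hx z hz, neg_zero]
  · rw [rot, h j k i hjk hik y hy z hz x hx]
  · rw [swap, rot, rot, h k j i hjk hij z hz y hy x hx, neg_zero]
  · rw [swap, rot, rot, h k j i hjk hij z hz y hy x hx, neg_zero]

end Cyclic

/-! ### The components of an element of the space -/

section Components

variable {F V A B C S : Type*} [Field F] [AddCommGroup V] [Module F V]
  [AddCommGroup A] [Module F A] [AddCommGroup B] [Module F B]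
  [AddCommGroup C] [Module F C] [AddCommGroup S] [Module F S]

/-- The slice of the component in `sl(V) ⊗ A`. -/
def coefA (φ : Module.Dual F (Sl F V)) : Total F V A B C S →ₗ[F] A :=
  slice φ ∘ₗ prA F V A B C S

/-- The slice of the component in `V ⊗ B`. -/
def coefB (φ : Module.Dual F V) : Total F V A B C S →ₗ[F] B :=
  slice φ ∘ₗ prB F V A B C S

/-- The slice of the component in `V* ⊗ C`. -/
def coefC (φ : Module.Dual F (Module.Dual F V)) : Total F V A B C S →ₗ[F] C :=
  slice φ ∘ₗ prC F V A B C S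

variable (φ : Module.Dual F (Sl F V)) (χ : Module.Dual F V)
  (w : Module.Dual F (Module.Dual F V))

@[simp] theorem coefA_inA (x : Sl F V) (a : A) :
    coefA φ (inA F V A B C S (x ⊗ₜ a)) = φ x • a := by simp [coefA]
@[simp] theorem coefA_inB (z : V ⊗[F] B) : coefA φ (inB F V A B C S z) = 0 := by simp [coefA]
@[simp] theorem coefA_inC (z : Module.Dual F V ⊗[F] C) :
    coefA φ (inC F V A B C S z) = 0 := by simp [coefA]
@[simp] theorem coefA_inS (d : S) : coefA φ (inS F V A B C S d) = 0 := by simp [coefA]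
@[simp] theorem coefB_inA (z : Sl F V ⊗[F] A) : coefB χ (inA F V A B C S z) = 0 := by
  simp [coefB]
@[simp] theorem coefB_inB (u : V) (b : B) :
    coefB χ (inB F V A B C S (u ⊗ₜ b)) = χ u • b := by simp [coefB]
@[simp] theorem coefB_inC (z : Module.Dual F V ⊗[F] C) :
    coefB χ (inC F V A B C S z) = 0 := by simp [coefB]
@[simp] theorem coefB_inS (d : S) : coefB χ (inS F V A B C S d) = 0 := by simp [coefB]
@[simp] theorem coefC_inA (z : Sl F V ⊗[F] A) : coefC w (inA F V A B C S z) = 0 := by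
  simp [coefC]
@[simp] theorem coefC_inB (z : V ⊗[F] B) : coefC w (inB F V A B C S z) = 0 := by
  simp [coefC]
@[simp] theorem coefC_inC (f : Module.Dual F V) (c : C) :
    coefC w (inC F V A B C S (f ⊗ₜ c)) = w f • c := by simp [coefC]
@[simp] theorem coefC_inS (d : S) : coefC w (inS F V A B C S d) = 0 := by simp [coefC]

theorem total_eq (z : Total F V A B C S) :
    z = inA F V A B C S (prA F V A B C S z) + inB F V A B C S (prB F V A B C S z)
      + inC F V A B C S (prC F V A B C S z) + inS F V A B C S (prS F V A B C S z) := by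
  obtain ⟨a, b, c, d⟩ := z
  change (a, b, c, d) = (a, (0 : V ⊗[F] B), (0 : Module.Dual F V ⊗[F] C), (0 : S))
    + ((0 : Sl F V ⊗[F] A), b, (0 : Module.Dual F V ⊗[F] C), (0 : S))
    + ((0 : Sl F V ⊗[F] A), (0 : V ⊗[F] B), c, (0 : S))
    + ((0 : Sl F V ⊗[F] A), (0 : V ⊗[F] B), (0 : Module.Dual F V ⊗[F] C), d)
  simp

variable (F V A B C S) in
/-- The pure tensors in the four summands. -/
def generators (i : Fin 4) : Set (Total F V A B C S) :=
  ![Set.range (inS F V A B C S),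
    Set.range fun p : Sl F V × A => inA F V A B C S (p.1 ⊗ₜ p.2),
    Set.range fun p : V × B => inB F V A B C S (p.1 ⊗ₜ p.2),
    Set.range fun p : Module.Dual F V × C => inC F V A B C S (p.1 ⊗ₜ p.2)] i

theorem span_generators : Submodule.span F (⋃ i, generators F V A B C S i) = ⊤ := by
  have mem : ∀ i, ∀ z ∈ generators F V A B C S i,
      z ∈ Submodule.span F (⋃ i, generators F V A B C S i) := fun i z hz =>
    Submodule.subset_span (Set.mem_iUnion.2 ⟨i, hz⟩)
  refine eq_top_iff.2 fun z _ => ?_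
  rw [total_eq z]
  refine add_mem (add_mem (add_mem ?_ ?_) ?_) (mem 0 _ ⟨_, rfl⟩)
  · induction prA F V A B C S z with
    | zero => simp
    | tmul x a => exact mem 1 _ ⟨(x, a), rfl⟩
    | add x y hx hy => rw [map_add]; exact add_mem hx hy
  · induction prB F V A B C S z with
    | zero => simp
    | tmul x a => exact mem 2 _ ⟨(x, a), rfl⟩
    | add x y hx hy => rw [map_add]; exact add_mem hx hy
  · induction prC F V A B C S z with
    | zero => simp
    | tmul x a => exact mem 3 _ ⟨(x, a), rfl⟩
    | add x y hx hy => rw [map_add]; exact add_mem hx hy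

theorem mem_range_inS_of_pr_eq_zero {z : Total F V A B C S} (hA : prA F V A B C S z = 0)
    (hB : prB F V A B C S z = 0) (hC : prC F V A B C S z = 0) :
    z ∈ LinearMap.range (inS F V A B C S) := by
  refine ⟨prS F V A B C S z, ?_⟩
  conv_rhs => rw [total_eq z, hA, hB, hC]
  simp

end Components
/-! ### Identities in a three-dimensional space -/

section Coordinates

variable {F V : Type*} [Field F] [AddCommGroup V] [Module F V]
  (e : Module.Basis (Fin 3) F V) (vol : V [⋀^Fin 3]→ₗ[F] F)

/-- A top form is a multiple of the determinant in any basis. This turns the identities below into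
polynomial identities in coordinates. -/
theorem vol_apply (u v w : V) : vol ![u, v, w] = vol e *
    (e.coord 0 u * e.coord 1 v * e.coord 2 w - e.coord 0 u * e.coord 2 v * e.coord 1 w
      - e.coord 1 u * e.coord 0 v * e.coord 2 w + e.coord 1 u * e.coord 2 v * e.coord 0 w
      + e.coord 2 u * e.coord 0 v * e.coord 1 w - e.coord 2 u * e.coord 1 v * e.coord 0 w) := by
  conv_lhs => rw [vol.eq_smul_basis_det e]
  simp only [AlternatingMap.smul_apply, Module.Basis.det_apply, Matrix.det_fin_three,
    Module.Basis.toMatrix_apply, smul_eq_mul, Module.Basis.coord_apply]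
  simp only [Matrix.cons_val]
  ring

theorem coord_end (x : Module.End F V) (i : Fin 3) (u : V) : e.coord i (x u) =
    e.coord i (x (e 0)) * e.coord 0 u + e.coord i (x (e 1)) * e.coord 1 u
      + e.coord i (x (e 2)) * e.coord 2 u := by
  conv_lhs => rw [← e.sum_repr u, Fin.sum_univ_three]
  simp only [map_add, map_smul, smul_eq_mul, Module.Basis.coord_apply]
  ring

theorem dual_apply (f : Module.Dual F V) (u : V) : f u =
    f (e 0) * e.coord 0 u + f (e 1) * e.coord 1 u + f (e 2) * e.coord 2 u := by
  conv_lhs => rw [← e.sum_repr u, Fin.sum_univ_three]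
  simp only [map_add, map_smul, smul_eq_mul, Module.Basis.coord_apply]
  ring

theorem trace_eq_sum (x : Module.End F V) : LinearMap.trace F V x =
    e.coord 0 (x (e 0)) + e.coord 1 (x (e 1)) + e.coord 2 (x (e 2)) := by
  rw [LinearMap.trace_eq_matrix_trace F e, Matrix.trace_fin_three]
  simp [LinearMap.toMatrix_apply]

theorem coord_ext {u v : V} (h : ∀ i, e.coord i u = e.coord i v) : u = v :=
  e.ext_elem h

theorem end_ext {x y : Module.End F V} (h : ∀ i j, e.coord i (x (e j)) = e.coord i (y (e j))) :
    x = y :=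
  e.ext fun j => coord_ext e fun i => h i j

theorem coord_basis (i j : Fin 3) : e.coord i (e j) = if j = i then 1 else 0 := by
  simp [Finsupp.single_apply]

end Coordinates

section Identities

variable {F V : Type*} [Field F] [AddCommGroup V] [Module F V]
  [hV : Fact (Module.finrank F V = 3)] (vol : V [⋀^Fin 3]→ₗ[F] F)

variable (F V) in
theorem exists_basis : Nonempty (Module.Basis (Fin 3) F V) :=
  have : Module.Finite F V := finite_of_fact
  ⟨Module.finBasisOfFinrankEq F V hV.out⟩

/-- This is the infinitesimal form of `det(g u, g v, g w) = det(g) det(u, v, w)`; for traceless `x`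
the right side vanishes. -/
theorem vol_end_add (x : Module.End F V) (u v w : V) :
    vol ![x u, v, w] + vol ![u, x v, w] + vol ![u, v, x w] =
      LinearMap.trace F V x * vol ![u, v, w] := by
  obtain ⟨e⟩ := exists_basis F V
  simp only [vol_apply e, coord_end e x _ u, coord_end e x _ v, coord_end e x _ w, trace_eq_sum e]
  ring

/-- Cramer's rule for `z` in terms of `u`, `v`, `w`, cleared of denominators so that no independence
is needed. -/
theorem vol_smul_add (u v w z : V) :
    vol ![u, v, z] • w + vol ![v, w, z] • u + vol ![w, u, z] • v = vol ![u, v, w] • z := by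
  obtain ⟨e⟩ := exists_basis F V
  refine coord_ext e fun i => ?_
  simp only [map_add, map_smul, smul_eq_mul, vol_apply e]
  fin_cases i <;> simp only [Fin.reduceFinMk] <;> ring

variable (e : Module.Basis (Fin 3) F V)

theorem dualForm_mul_basis (hvol : vol ≠ 0) (f g h : Module.Dual F V) :
    dualForm vol ![f, g, h] * vol e =
      f (e 0) * g (e 1) * h (e 2) - f (e 0) * g (e 2) * h (e 1) - f (e 1) * g (e 0) * h (e 2)
        + f (e 1) * g (e 2) * h (e 0) + f (e 2) * g (e 0) * h (e 1)
        - f (e 2) * g (e 1) * h (e 0) := by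
  rw [dualForm_mul vol hvol, Matrix.det_fin_three]
  simp [Matrix.cons_val]

include e in
omit hV in
theorem vol_basis_ne_zero (hvol : vol ≠ 0) : vol e ≠ 0 :=
  (AlternatingMap.map_basis_ne_zero_iff e vol).2 hvol

theorem dualForm_end_add (hvol : vol ≠ 0) (x : Module.End F V) (f g h : Module.Dual F V) :
    dualForm vol ![f ∘ₗ x, g, h] + dualForm vol ![f, g ∘ₗ x, h] + dualForm vol ![f, g, h ∘ₗ x] =
      LinearMap.trace F V x * dualForm vol ![f, g, h] := by
  obtain ⟨e⟩ := exists_basis F V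
  -- The factor `vol e` cancels the inverse in `dualForm`, which leaves a polynomial identity.
  apply mul_right_cancel₀ (vol_basis_ne_zero vol e hvol)
  simp only [add_mul, mul_assoc, dualForm_mul_basis vol e hvol, trace_eq_sum e,
    LinearMap.comp_apply, dual_apply e f (x _), dual_apply e g (x _), dual_apply e h (x _)]
  ring

theorem dualForm_smul_add (hvol : vol ≠ 0) (f g h k : Module.Dual F V) :
    dualForm vol ![f, g, k] • h + dualForm vol ![g, h, k] • f + dualForm vol ![h, f, k] • g =
      dualForm vol ![f, g, h] • k := by
  obtain ⟨e⟩ := exists_basis F V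
  refine e.ext fun i => ?_
  apply mul_right_cancel₀ (vol_basis_ne_zero vol e hvol)
  simp only [LinearMap.add_apply, LinearMap.smul_apply, smul_eq_mul, add_mul,
    mul_right_comm _ _ (vol e), dualForm_mul_basis vol e hvol]
  fin_cases i <;> simp only [Fin.reduceFinMk] <;> ring

/-- The analogue of the double cross product formula. The forms on `V` and `V*` scale inversely, so
the result does not depend on the normalization of `vol`. -/
theorem wedgeDual_wedgeForm (hvol : vol ≠ 0) (u v : V) (f : Module.Dual F V) :
    wedgeDual vol (wedgeForm vol u v) f = f u • v - f v • u := by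
  obtain ⟨e⟩ := exists_basis F V
  refine coord_ext e fun i => ?_
  apply mul_right_cancel₀ (vol_basis_ne_zero vol e hvol)
  simp only [apply_wedgeDual, dualForm_mul_basis vol e hvol,
    wedgeForm_apply, map_sub, map_smul, smul_eq_mul, dual_apply e f u, dual_apply e f v,
    vol_apply e vol u v]
  fin_cases i <;> simp <;> ring

theorem wedgeForm_wedgeDual (hvol : vol ≠ 0) (u : V) (f g : Module.Dual F V) :
    wedgeForm vol u (wedgeDual vol f g) = g u • f - f u • g := by
  obtain ⟨e⟩ := exists_basis F V
  -- Scaled by `vol e`, the coordinates of `f ∧ g` are the 2 × 2 minors of `f` and `g`; they enter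
  -- the expansion of `vol` in just this scaling.
  have key : ∀ i, vol e * e.coord i (wedgeDual vol f g) = _ := fun i => by
    rw [mul_comm, apply_wedgeDual, dualForm_mul_basis vol e hvol]
  refine e.ext fun j => ?_
  rw [wedgeForm_apply, vol_apply e]
  simp only [LinearMap.sub_apply, LinearMap.smul_apply, smul_eq_mul, dual_apply e f u,
    dual_apply e g u]
  have h0 := key 0
  have h1 := key 1
  have h2 := key 2
  simp only [coord_basis] at h0 h1 h2 ⊢
  fin_cases j <;> simp at h0 h1 h2 ⊢
  · linear_combination e.repr u 1 * h2 - e.repr u 2 * h1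
  · linear_combination e.repr u 2 * h0 - e.repr u 0 * h2
  · linear_combination e.repr u 0 * h1 - e.repr u 1 * h0

end Identities

section CayleyHamilton

variable {F V : Type*} [Field F] [AddCommGroup V] [Module F V]
  [hV : Fact (Module.finrank F V = 3)]

set_option maxHeartbeats 4000000 in
/-- The polarized Cayley–Hamilton identity. -/
theorem sum_perm_mul {x y z : Module.End F V} (hx : LinearMap.trace F V x = 0)
    (hy : LinearMap.trace F V y = 0) (hz : LinearMap.trace F V z = 0) :
    x * y * z + y * z * x + z * x * y + x * z * y + z * y * x + y * x * z =
      LinearMap.trace F V (x * y) • z + LinearMap.trace F V (y * z) • x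
        + LinearMap.trace F V (z * x) • y
        + (LinearMap.trace F V (x * y * z) + LinearMap.trace F V (x * z * y)) • 1 := by
  obtain ⟨e⟩ := exists_basis F V
  have hc : ∀ (x y : Module.End F V) (i j : Fin 3), e.coord i ((x * y) (e j)) = _ :=
    fun x y i j => by rw [Module.End.mul_apply, coord_end e x i (y (e j))]
  -- The vanishing trace eliminates the last diagonal entry, after which each matrix entry of the
  -- identity is polynomial in free variables.
  have expand : ∀ w : Module.End F V, LinearMap.trace F V w = 0 →
      e.coord 2 (w (e 2)) = -e.coord 0 (w (e 0)) - e.coord 1 (w (e 1)) := fun w hw => by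
    rw [trace_eq_sum e] at hw
    linear_combination hw
  refine end_ext e fun i j => ?_
  simp only [LinearMap.add_apply, LinearMap.smul_apply, map_add, map_smul, smul_eq_mul, hc,
    trace_eq_sum e, Module.End.one_apply, coord_basis]
  fin_cases i <;> fin_cases j <;>
    simp only [Fin.reduceFinMk, Fin.isValue, expand x hx, expand y hy, expand z hz,
      Fin.reduceEq, reduceIte, mul_one, mul_zero] <;> ring

end CayleyHamilton
/-! ### Traceless parts -/

section Traceless

variable {F V : Type*} [Field F] [AddCommGroup V] [Module F V]

theorem trace_coe (x : Sl F V) : LinearMap.trace F V x.1 = 0 := x.2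

theorem slForm_symm (x y : Sl F V) : slForm x y = slForm y x := by
  rw [slForm_apply, slForm_apply, LinearMap.trace_mul_comm]

theorem wedgeForm_anti {W : Type*} [AddCommGroup W] [Module F W] (ω : W [⋀^Fin 3]→ₗ[F] F)
    (u v : W) : wedgeForm ω u v = -wedgeForm ω v u := by
  ext w
  rw [LinearMap.neg_apply, wedgeForm_apply, wedgeForm_apply]
  have h := ω.map_swap ![v, u, w] (show (0 : Fin 3) ≠ 1 by decide)
  rw [← h]
  congr 1
  ext i
  fin_cases i <;> rfl

theorem alternating_rotate {W : Type*} [AddCommGroup W] [Module F W] (ω : W [⋀^Fin 3]→ₗ[F] F)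
    (u v w : W) : ω ![v, w, u] = ω ![u, v, w] := by
  have h := ω.map_perm ![u, v, w] (finRotate 3)
  rw [show Equiv.Perm.sign (finRotate 3) = 1 by decide, one_smul] at h
  rw [← h]
  congr 1
  ext i
  fin_cases i <;> rfl

variable [hV : Fact (Module.finrank F V = 3)] [NeZero (3 : F)]

omit [NeZero (3 : F)] in
theorem wedgeDual_anti (ω : V [⋀^Fin 3]→ₗ[F] F) (f g : Module.Dual F V) :
    wedgeDual ω f g = -wedgeDual ω g f := by
  rw [wedgeDual, LinearMap.compr₂_apply, LinearMap.compr₂_apply, wedgeForm_anti, map_neg]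

@[simp] theorem traceless_coe (x : Sl F V) : traceless x.1 = x := by
  ext1
  rw [coe_traceless, trace_coe]
  simp

@[simp] theorem traceless_one : traceless (1 : Module.End F V) = 0 := by
  have : Module.Finite F V := finite_of_fact
  ext1
  rw [coe_traceless, LinearMap.trace_one, hV.out]
  simp [inv_mul_cancel₀ (NeZero.ne (3 : F))]

theorem slBracket_eq (x y : Sl F V) :
    slBracket x y = traceless (x.1 * y.1) - traceless (y.1 * x.1) := by
  rw [← map_sub]; rfl

theorem slCirc_eq (x y : Sl F V) :
    slCirc x y = traceless (x.1 * y.1) + traceless (y.1 * x.1) := by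
  rw [← map_add]; rfl

theorem rankOne_eq (u : V) (f : Module.Dual F V) : rankOne u f = traceless (f.smulRight u) := rfl

theorem slForm_traceless (m : Module.End F V) (z : Sl F V) :
    slForm (traceless m) z = (3 : F)⁻¹ * LinearMap.trace F V (m * z.1) := by
  rw [slForm_apply, coe_traceless, sub_mul, smul_mul_assoc, one_mul, map_sub, map_smul,
    trace_coe, smul_zero, sub_zero]

end Traceless

namespace BracketData

variable {F V A B C S : Type*} [Field F] [AddCommGroup V] [Module F V]
  [AddCommGroup A] [Module F A] [AddCommGroup B] [Module F B]
  [AddCommGroup C] [Module F C] [AddCommGroup S] [Module F S]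
  (D : BracketData F V A B C S)

/-! ### The product of `A` -/

section Product

theorem mulA_apply (a b : A) :
    D.mulA a b = (2 : F)⁻¹ • D.circ a b + (2 : F)⁻¹ • D.comm a b := rfl

theorem mulA_swap (a b : A) :
    D.mulA b a = (2 : F)⁻¹ • D.circ a b - (2 : F)⁻¹ • D.comm a b := by
  rw [mulA_apply, D.circ_comm b a, D.comm_anti b a, smul_neg, sub_eq_add_neg]

theorem comm_eq [h2 : NeZero (2 : F)] (a b : A) : D.comm a b = D.mulA a b - D.mulA b a := by
  have h : (2 : F)⁻¹ + (2 : F)⁻¹ = 1 := by rw [← two_mul, mul_inv_cancel₀ h2.out]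
  rw [mulA_swap D a b, mulA_apply]
  calc D.comm a b = ((2 : F)⁻¹ + (2 : F)⁻¹) • D.comm a b := by rw [h, one_smul]
    _ = _ := by module

theorem circ_eq [h2 : NeZero (2 : F)] (a b : A) : D.circ a b = D.mulA a b + D.mulA b a := by
  have h : (2 : F)⁻¹ + (2 : F)⁻¹ = 1 := by rw [← two_mul, mul_inv_cancel₀ h2.out]
  rw [mulA_swap D a b, mulA_apply]
  calc D.circ a b = ((2 : F)⁻¹ + (2 : F)⁻¹) • D.circ a b := by rw [h, one_smul]
    _ = _ := by module

end Product

variable [hV : Fact (Module.finrank F V = 3)] [NeZero (3 : F)] (vol : V [⋀^Fin 3]→ₗ[F] F)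

/-! ### Anticommutativity -/

theorem brAA_anti (z w : Sl F V ⊗[F] A) : D.brAA z w = -D.brAA w z := by
  induction z with
  | zero => simp
  | add z z' hz hz' => simp only [map_add, LinearMap.add_apply, hz, hz', neg_add]
  | tmul x a =>
  induction w with
  | zero => simp
  | add w w' hw hw' => simp only [map_add, LinearMap.add_apply, hw, hw', neg_add]
  | tmul y b =>
    simp only [brAA, LinearMap.add_apply, LinearMap.compr₂_apply, TensorProduct.map₂_apply_tmul,
      TensorProduct.map_tmul,
      scalarTensor, LinearMap.smul_apply, LinearEquiv.coe_coe, TensorProduct.lid_tmul]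
    rw [D.comm_anti a b, D.circ_comm a b, D.dA_skew a b, slBracket_eq, slBracket_eq, slCirc_eq,
      slCirc_eq, slForm_symm x y]
    simp only [TensorProduct.add_tmul, TensorProduct.sub_tmul, TensorProduct.tmul_smul,
      map_add, map_sub, map_smul, map_tmul_neg, map_neg]
    module

omit hV [NeZero (3 : F)] in
theorem brBB_anti (z w : V ⊗[F] B) : D.brBB vol z w = -D.brBB vol w z := by
  induction z with
  | zero => simp
  | add z z' hz hz' => simp only [map_add, LinearMap.add_apply, hz, hz', neg_add]
  | tmul x a =>
  induction w with
  | zero => simp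
  | add w w' hw hw' => simp only [map_add, LinearMap.add_apply, hw, hw', neg_add]
  | tmul y b =>
    simp only [brBB, LinearMap.compr₂_apply, TensorProduct.map₂_apply_tmul, TensorProduct.map_tmul]
    rw [D.crossB_symm, wedgeForm_anti, map_neg_tmul]

omit [NeZero (3 : F)] in
theorem brCC_anti (z w : Module.Dual F V ⊗[F] C) : D.brCC vol z w = -D.brCC vol w z := by
  induction z with
  | zero => simp
  | add z z' hz hz' => simp only [map_add, LinearMap.add_apply, hz, hz', neg_add]
  | tmul x a =>
  induction w with
  | zero => simp
  | add w w' hw hw' => simp only [map_add, LinearMap.add_apply, hw, hw', neg_add]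
  | tmul y b =>
    simp only [brCC, LinearMap.compr₂_apply, TensorProduct.map₂_apply_tmul, TensorProduct.map_tmul]
    rw [D.crossC_symm, wedgeDual_anti, map_neg_tmul]

theorem bracket_anti (z w : Total F V A B C S) : D.bracket vol z w = -D.bracket vol w z := by
  simp only [bracket, LinearMap.add_apply, LinearMap.sub_apply, LinearMap.compl₁₂_apply,
    LinearMap.flip_apply]
  rw [brAA_anti, brBB_anti, brCC_anti, D.sS_anti]
  abel

theorem bracket_self [h2 : NeZero (2 : F)] (z : Total F V A B C S) : D.bracket vol z z = 0 := by
  have h := D.bracket_anti vol z z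
  have h' : (2 : F) • D.bracket vol z z = 0 := by
    rw [two_smul]; nth_rw 1 [h]; exact neg_add_cancel _
  exact (smul_eq_zero.1 h').resolve_left h2.out

/-! ### The remaining brackets of generators -/

/-- Regrouping the commutator and circle terms by the words `xy` and `yx` pairs them with `ab` and
`ba`. In this form triple brackets produce associators of `A`. -/
theorem bracket_A_A_eq (x y : Sl F V) (a b : A) :
    D.bracket vol (inA F V A B C S (x ⊗ₜ a)) (inA F V A B C S (y ⊗ₜ b)) =
      inA F V A B C S (traceless (x.1 * y.1) ⊗ₜ D.mulA a b)
        - inA F V A B C S (traceless (y.1 * x.1) ⊗ₜ D.mulA b a)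
        + inS F V A B C S (slForm x y • D.dA a b) := by
  rw [bracket_A_A, slBracket_eq, slCirc_eq, mulA_swap D a b, mulA_apply]
  simp only [TensorProduct.add_tmul, TensorProduct.sub_tmul, TensorProduct.tmul_smul,
    TensorProduct.tmul_sub, TensorProduct.tmul_add, map_add, map_sub, map_smul]
  module

theorem bracket_B_A (x : Sl F V) (u : V) (a : A) (b : B) :
    D.bracket vol (inB F V A B C S (u ⊗ₜ b)) (inA F V A B C S (x ⊗ₜ a)) =
      -inB F V A B C S (x.1 u ⊗ₜ D.actB a b) := by
  rw [bracket_anti, bracket_A_B]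

theorem bracket_A_C (f : Module.Dual F V) (x : Sl F V) (c : C) (a : A) :
    D.bracket vol (inA F V A B C S (x ⊗ₜ a)) (inC F V A B C S (f ⊗ₜ c)) =
      -inC F V A B C S ((f ∘ₗ x.1) ⊗ₜ D.actC c a) := by
  rw [bracket_anti, bracket_C_A]

theorem bracket_C_B (u : V) (f : Module.Dual F V) (b : B) (c : C) :
    D.bracket vol (inC F V A B C S (f ⊗ₜ c)) (inB F V A B C S (u ⊗ₜ b)) =
      -inA F V A B C S (rankOne u f ⊗ₜ D.t b c)
        - inS F V A B C S (((3 : F)⁻¹ * f u) • D.dBC b c) := by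
  rw [bracket_anti, bracket_B_C]; abel

theorem bracket_A_S (d : S) (x : Sl F V) (a : A) :
    D.bracket vol (inA F V A B C S (x ⊗ₜ a)) (inS F V A B C S d) =
      -inA F V A B C S (x ⊗ₜ D.sA d a) := by
  rw [bracket_anti, bracket_S_A]

theorem bracket_B_S (d : S) (u : V) (b : B) :
    D.bracket vol (inB F V A B C S (u ⊗ₜ b)) (inS F V A B C S d) =
      -inB F V A B C S (u ⊗ₜ D.sB d b) := by
  rw [bracket_anti, bracket_S_B]

theorem bracket_C_S (d : S) (f : Module.Dual F V) (c : C) :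
    D.bracket vol (inC F V A B C S (f ⊗ₜ c)) (inS F V A B C S d) =
      -inC F V A B C S (f ⊗ₜ D.sC d c) := by
  rw [bracket_anti, bracket_S_C]

variable {D} in
omit hV [NeZero (3 : F)] in
theorem SClosed.eq (h : D.SClosed) (d d' : S) : D.sS d d' = inS F V A B C S (D.brS d d') := by
  obtain ⟨z, hz⟩ := h d d'
  simp [brS, ← hz]

end BracketData
end SlThree

namespace SlThree
namespace BracketData

variable {F V A B C S : Type*} [Field F] [AddCommGroup V] [Module F V]
  [AddCommGroup A] [Module F A] [AddCommGroup B] [Module F B]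
  [AddCommGroup C] [Module F C] [AddCommGroup S] [Module F S]
  (D : BracketData F V A B C S)
  [hV : Fact (Module.finrank F V = 3)] [NeZero (3 : F)] (vol : V [⋀^Fin 3]→ₗ[F] F)

/-! ### The Jacobi sums of generators -/

local notation "ιA" => inA F V A B C S
local notation "ιB" => inB F V A B C S
local notation "ιC" => inC F V A B C S
local notation "ιS" => inS F V A B C S

/-- The associator of the product of `A`. -/
def assocA (a b c : A) : A := D.mulA (D.mulA a b) c - D.mulA a (D.mulA b c)

/-- The difference of the two sides of the formula for `D_{a, b} c`. -/
def defectA (a b c : A) : A :=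
  D.sA (D.dA a b) c - D.mulA (D.mulA a b - D.mulA b a) c + D.mulA c (D.mulA a b - D.mulA b a)

/-- Each word in `x`, `y`, `z` arises from two bracketings, whose difference is an associator. The
scalar part removed from an inner product such as `xy` is `(x | y) I`; its contribution joins the
action of `D_{a,b}` to form `defectA`. -/
theorem jacobiator_A_A_A (x y z : Sl F V) (a b c : A) :
    jacobiator (D.bracket vol) (ιA (x ⊗ₜ a)) (ιA (y ⊗ₜ b)) (ιA (z ⊗ₜ c)) =
      ιA (traceless (x.1 * y.1 * z.1) ⊗ₜ D.assocA a b c)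
      + ιA (traceless (y.1 * z.1 * x.1) ⊗ₜ D.assocA b c a)
      + ιA (traceless (z.1 * x.1 * y.1) ⊗ₜ D.assocA c a b)
      - ιA (traceless (z.1 * y.1 * x.1) ⊗ₜ D.assocA c b a)
      - ιA (traceless (x.1 * z.1 * y.1) ⊗ₜ D.assocA a c b)
      - ιA (traceless (y.1 * x.1 * z.1) ⊗ₜ D.assocA b a c)
      + slForm x y • ιA (z ⊗ₜ D.defectA a b c)
      + slForm y z • ιA (x ⊗ₜ D.defectA b c a)
      + slForm z x • ιA (y ⊗ₜ D.defectA c a b)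
      + ((3 : F)⁻¹ * LinearMap.trace F V (x.1 * y.1 * z.1)) •
        ιS (D.dA (D.mulA a b) c + D.dA (D.mulA b c) a + D.dA (D.mulA c a) b)
      - ((3 : F)⁻¹ * LinearMap.trace F V (z.1 * y.1 * x.1)) •
        ιS (D.dA (D.mulA b a) c + D.dA (D.mulA c b) a + D.dA (D.mulA a c) b) := by
  -- Cyclic invariance reduces all traces of triple products to `tr(xyz)` and `tr(zyx)`.
  have t1 := LinearMap.trace_mul_cycle F x.1 y.1 z.1
  have t2 := LinearMap.trace_mul_cycle F z.1 x.1 y.1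
  have t3 := LinearMap.trace_mul_cycle F z.1 y.1 x.1
  have t4 := LinearMap.trace_mul_cycle F x.1 z.1 y.1
  have s1 := LinearMap.trace_mul_comm F x.1 y.1
  have s2 := LinearMap.trace_mul_comm F y.1 z.1
  have s3 := LinearMap.trace_mul_comm F z.1 x.1
  simp only [jacobiator, bracket_A_A_eq, bracket_S_A, map_add, map_sub, map_smul,
    LinearMap.add_apply, LinearMap.sub_apply, LinearMap.smul_apply, trace_coe, smul_zero, sub_zero,
    coe_traceless, sub_mul, mul_sub, smul_mul_assoc, mul_smul_comm, one_mul, mul_one,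
    traceless_coe, TensorProduct.sub_tmul, ← TensorProduct.smul_tmul', TensorProduct.tmul_sub,
    TensorProduct.tmul_add, defectA, assocA, slForm_apply, ← mul_assoc,
    ← t1, ← t2, ← t3, ← t4, s1, s2, s3]
  module

theorem jacobiator_A_A_B (x y : Sl F V) (u : V) (a b : A) (m : B) :
    jacobiator (D.bracket vol) (ιA (x ⊗ₜ a)) (ιA (y ⊗ₜ b)) (ιB (u ⊗ₜ m)) =
      ιB (x.1 (y.1 u) ⊗ₜ (D.actB (D.mulA a b) m - D.actB a (D.actB b m)))
      - ιB (y.1 (x.1 u) ⊗ₜ (D.actB (D.mulA b a) m - D.actB b (D.actB a m)))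
      + slForm x y • ιB (u ⊗ₜ (D.sB (D.dA a b) m - D.actB (D.mulA a b - D.mulA b a) m)) := by
  have s1 := LinearMap.trace_mul_comm F x.1 y.1
  simp only [jacobiator, bracket_A_A_eq, bracket_S_B, bracket_A_B, bracket_B_A, map_add, map_sub,
    map_smul, map_neg, LinearMap.neg_apply, slForm_apply, s1,
    LinearMap.add_apply, LinearMap.sub_apply, LinearMap.smul_apply,
    coe_traceless, Module.End.mul_apply, Module.End.one_apply,
    TensorProduct.sub_tmul, ← TensorProduct.smul_tmul', TensorProduct.tmul_sub]
  module

theorem jacobiator_A_A_C (x y : Sl F V) (f : Module.Dual F V) (a b : A) (c : C) :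
    jacobiator (D.bracket vol) (ιA (x ⊗ₜ a)) (ιA (y ⊗ₜ b)) (ιC (f ⊗ₜ c)) =
      ιC ((f ∘ₗ x.1 ∘ₗ y.1) ⊗ₜ (D.actC (D.actC c a) b - D.actC c (D.mulA a b)))
      - ιC ((f ∘ₗ y.1 ∘ₗ x.1) ⊗ₜ (D.actC (D.actC c b) a - D.actC c (D.mulA b a)))
      + slForm x y • ιC (f ⊗ₜ (D.sC (D.dA a b) c - D.actC c (D.mulA b a - D.mulA a b))) := by
  have s1 := LinearMap.trace_mul_comm F x.1 y.1
  have hf : ∀ x y : Module.End F V, f ∘ₗ (x * y) = f ∘ₗ x ∘ₗ y := fun _ _ => rfl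
  have hf1 : f ∘ₗ (1 : Module.End F V) = f := rfl
  simp only [jacobiator, bracket_A_A_eq, bracket_S_C, bracket_A_C, bracket_C_A, map_add, map_sub,
    map_smul, map_neg, LinearMap.neg_apply, slForm_apply, s1,
    LinearMap.add_apply, LinearMap.sub_apply, LinearMap.smul_apply, LinearMap.comp_sub,
    coe_traceless, LinearMap.comp_smul, LinearMap.comp_assoc, hf, hf1,
    TensorProduct.sub_tmul, ← TensorProduct.smul_tmul', TensorProduct.tmul_sub]
  module

theorem jacobiator_A_B_B (x : Sl F V) (u v : V) (a : A) (m n : B) :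
    jacobiator (D.bracket vol) (ιA (x ⊗ₜ a)) (ιB (u ⊗ₜ m)) (ιB (v ⊗ₜ n)) =
      ιC (wedgeForm vol (x.1 u) v ⊗ₜ D.crossB (D.actB a m) n)
      + ιC (wedgeForm vol u (x.1 v) ⊗ₜ D.crossB m (D.actB a n))
      + ιC ((wedgeForm vol u v ∘ₗ x.1) ⊗ₜ D.actC (D.crossB m n) a) := by
  simp only [jacobiator, bracket_A_B, bracket_B_A, bracket_B_B, bracket_C_A, map_neg,
    LinearMap.neg_apply]
  rw [wedgeForm_anti vol (x.1 v) u, map_neg_tmul, D.crossB_symm (D.actB a n) m]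
  module

theorem jacobiator_A_C_C (x : Sl F V) (f g : Module.Dual F V) (a : A) (c d : C) :
    jacobiator (D.bracket vol) (ιA (x ⊗ₜ a)) (ιC (f ⊗ₜ c)) (ιC (g ⊗ₜ d)) =
      -ιB (wedgeDual vol (f ∘ₗ x.1) g ⊗ₜ D.crossC (D.actC c a) d)
      - ιB (wedgeDual vol f (g ∘ₗ x.1) ⊗ₜ D.crossC c (D.actC d a))
      - ιB (x.1 (wedgeDual vol f g) ⊗ₜ D.actB a (D.crossC c d)) := by
  simp only [jacobiator, bracket_A_C, bracket_C_A, bracket_C_C, bracket_B_A, map_neg,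
    LinearMap.neg_apply]
  rw [wedgeDual_anti vol (g ∘ₗ x.1) f, map_neg_tmul, D.crossC_symm (D.actC d a) c]
  module

theorem jacobiator_A_B_C (x : Sl F V) (u : V) (f : Module.Dual F V) (a : A) (m : B) (c : C) :
    jacobiator (D.bracket vol) (ιA (x ⊗ₜ a)) (ιB (u ⊗ₜ m)) (ιC (f ⊗ₜ c)) =
      ιA (traceless (f.smulRight (x.1 u)) ⊗ₜ (D.t (D.actB a m) c - D.mulA a (D.t m c)))
      + ιA (traceless ((f ∘ₗ x.1).smulRight u) ⊗ₜ (D.mulA (D.t m c) a - D.t m (D.actC c a)))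
      + ((3 : F)⁻¹ * f u) • ιA (x ⊗ₜ (D.sA (D.dBC m c) a
          - (D.mulA (D.t m c) a - D.mulA a (D.t m c))))
      + ((3 : F)⁻¹ * f (x.1 u)) • ιS (D.dBC (D.actB a m) c - D.dBC m (D.actC c a)
          - D.dA a (D.t m c)) := by
  have hr1 : ∀ x : Module.End F V, f.smulRight u * x = (f ∘ₗ x).smulRight u := fun _ => rfl
  have hr2 : x.1 * f.smulRight u = f.smulRight (x.1 u) := by ext; simp
  have : Module.Finite F V := finite_of_fact
  simp only [jacobiator, bracket_A_B, bracket_A_A_eq, bracket_S_A, bracket_B_C, bracket_C_A,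
    bracket_C_B, map_add, map_sub, map_smul, slForm_traceless,
    LinearMap.add_apply, LinearMap.smul_apply, rankOne_eq, hr1, hr2,
    coe_traceless, sub_mul, mul_sub, smul_mul_assoc, mul_smul_comm, one_mul, mul_one,
    LinearMap.trace_smulRight, LinearMap.comp_apply, traceless_coe,
    TensorProduct.sub_tmul, ← TensorProduct.smul_tmul', TensorProduct.tmul_sub]
  rw [D.dA_skew a]
  simp only [map_neg]
  module

theorem jacobiator_B_B_B (u v w : V) (m n p : B) :
    jacobiator (D.bracket vol) (ιB (u ⊗ₜ m)) (ιB (v ⊗ₜ n)) (ιB (w ⊗ₜ p)) =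
      -ιA (rankOne w (wedgeForm vol u v) ⊗ₜ D.t p (D.crossB m n))
      - ιA (rankOne u (wedgeForm vol v w) ⊗ₜ D.t m (D.crossB n p))
      - ιA (rankOne v (wedgeForm vol w u) ⊗ₜ D.t n (D.crossB p m))
      - ((3 : F)⁻¹ * vol ![u, v, w]) •
        ιS (D.dBC p (D.crossB m n) + D.dBC m (D.crossB n p) + D.dBC n (D.crossB p m)) := by
  simp only [jacobiator, bracket_B_B, bracket_C_B, map_add, map_smul, wedgeForm_apply,
    alternating_rotate vol u v w, alternating_rotate vol w u v]
  module

theorem jacobiator_C_C_C (f g h : Module.Dual F V) (c d k : C) :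
    jacobiator (D.bracket vol) (ιC (f ⊗ₜ c)) (ιC (g ⊗ₜ d)) (ιC (h ⊗ₜ k)) =
      ιA (rankOne (wedgeDual vol f g) h ⊗ₜ D.t (D.crossC c d) k)
      + ιA (rankOne (wedgeDual vol g h) f ⊗ₜ D.t (D.crossC d k) c)
      + ιA (rankOne (wedgeDual vol h f) g ⊗ₜ D.t (D.crossC k c) d)
      + ((3 : F)⁻¹ * dualForm vol ![f, g, h]) •
        ιS (D.dBC (D.crossC c d) k + D.dBC (D.crossC d k) c + D.dBC (D.crossC k c) d) := by
  simp only [jacobiator, bracket_C_C, bracket_B_C, map_add, map_smul, apply_wedgeDual,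
    alternating_rotate (dualForm vol) f g h, alternating_rotate (dualForm vol) h f g]
  module

/-- The double wedge `(u ∧ v) ∧ f` and the endomorphism `w ↦ f(w) u` yield only `f(u) v` and `f(v)
u`. The two coefficients are exchanged by swapping `m` and `n`, up to sign, so a single equation
controls both. -/
theorem jacobiator_B_B_C (hvol : vol ≠ 0) (u v : V) (f : Module.Dual F V) (m n : B) (c : C) :
    jacobiator (D.bracket vol) (ιB (u ⊗ₜ m)) (ιB (v ⊗ₜ n)) (ιC (f ⊗ₜ c)) =
      f u • ιB (v ⊗ₜ (D.crossC (D.crossB m n) c + D.actB (D.t n c) m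
        + (3 : F)⁻¹ • D.actB (D.t m c) n - (3 : F)⁻¹ • D.sB (D.dBC m c) n))
      - f v • ιB (u ⊗ₜ (D.crossC (D.crossB n m) c + D.actB (D.t m c) n
        + (3 : F)⁻¹ • D.actB (D.t n c) m - (3 : F)⁻¹ • D.sB (D.dBC n c) m)) := by
  have : Module.Finite F V := finite_of_fact
  simp only [jacobiator, bracket_B_B, bracket_B_C, bracket_C_B, bracket_C_C, bracket_A_B,
    bracket_S_B, map_add, map_sub, map_smul, map_neg, LinearMap.neg_apply,
    LinearMap.add_apply, LinearMap.sub_apply, LinearMap.smul_apply, rankOne_eq, coe_traceless,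
    LinearMap.trace_smulRight, LinearMap.smulRight_apply, Module.End.one_apply,
    wedgeDual_wedgeForm vol hvol, D.crossB_symm n m,
    TensorProduct.sub_tmul, ← TensorProduct.smul_tmul', TensorProduct.tmul_sub,
    TensorProduct.tmul_add, TensorProduct.tmul_smul]
  module

theorem jacobiator_B_C_C (hvol : vol ≠ 0) (u : V) (f g : Module.Dual F V) (m : B) (c d : C) :
    jacobiator (D.bracket vol) (ιB (u ⊗ₜ m)) (ιC (f ⊗ₜ c)) (ιC (g ⊗ₜ d)) =
      f u • ιC (g ⊗ₜ (D.crossB m (D.crossC d c) + D.actC c (D.t m d)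
        + (3 : F)⁻¹ • D.actC d (D.t m c) + (3 : F)⁻¹ • D.sC (D.dBC m c) d))
      - g u • ιC (f ⊗ₜ (D.crossB m (D.crossC c d) + D.actC d (D.t m c)
        + (3 : F)⁻¹ • D.actC c (D.t m d) + (3 : F)⁻¹ • D.sC (D.dBC m d) c)) := by
  have : Module.Finite F V := finite_of_fact
  have hr : ∀ f g : Module.Dual F V, g ∘ₗ f.smulRight u = g u • f := fun f g => by
    ext v; simp [mul_comm]
  have h1 : ∀ g : Module.Dual F V, g ∘ₗ (1 : Module.End F V) = g := fun _ => rfl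
  have hw : wedgeForm vol (wedgeDual vol f g) u = f u • g - g u • f := by
    rw [wedgeForm_anti, wedgeForm_wedgeDual vol hvol, neg_sub]
  simp only [jacobiator, bracket_C_C, bracket_B_C, bracket_C_B, bracket_B_B, bracket_A_C,
    bracket_S_C, map_add, map_sub, map_smul, map_neg, LinearMap.neg_apply,
    LinearMap.add_apply, LinearMap.sub_apply, LinearMap.smul_apply, rankOne_eq, coe_traceless,
    LinearMap.trace_smulRight, LinearMap.comp_sub, LinearMap.comp_smul, hr, h1, hw,
    D.crossC_symm d c, D.crossB_symm (D.crossC c d) m,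
    TensorProduct.sub_tmul, ← TensorProduct.smul_tmul', TensorProduct.tmul_add, TensorProduct.tmul_smul]
  module

/-! ### The Jacobi sums that involve `S` -/

theorem jacobiator_S_S_S (h : D.SClosed) (d d' d'' : S) :
    jacobiator (D.bracket vol) (ιS d) (ιS d') (ιS d'') =
      ιS (D.brS (D.brS d d') d'' + D.brS (D.brS d' d'') d + D.brS (D.brS d'' d) d') := by
  simp only [jacobiator, bracket_S_S, h.eq, map_add]

theorem jacobiator_S_S_A (h : D.SClosed) (d d' : S) (x : Sl F V) (a : A) :
    jacobiator (D.bracket vol) (ιS d) (ιS d') (ιA (x ⊗ₜ a)) =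
      ιA (x ⊗ₜ (D.sA (D.brS d d') a - (D.sA d (D.sA d' a) - D.sA d' (D.sA d a)))) := by
  simp only [jacobiator, bracket_S_S, bracket_S_A, bracket_A_S, h.eq, map_neg,
    LinearMap.neg_apply, TensorProduct.tmul_sub, map_sub]
  module

theorem jacobiator_S_S_B (h : D.SClosed) (d d' : S) (u : V) (b : B) :
    jacobiator (D.bracket vol) (ιS d) (ιS d') (ιB (u ⊗ₜ b)) =
      ιB (u ⊗ₜ (D.sB (D.brS d d') b - (D.sB d (D.sB d' b) - D.sB d' (D.sB d b)))) := by
  simp only [jacobiator, bracket_S_S, bracket_S_B, bracket_B_S, h.eq, map_neg,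
    LinearMap.neg_apply, TensorProduct.tmul_sub, map_sub]
  module

theorem jacobiator_S_S_C (h : D.SClosed) (d d' : S) (f : Module.Dual F V) (c : C) :
    jacobiator (D.bracket vol) (ιS d) (ιS d') (ιC (f ⊗ₜ c)) =
      ιC (f ⊗ₜ (D.sC (D.brS d d') c - (D.sC d (D.sC d' c) - D.sC d' (D.sC d c)))) := by
  simp only [jacobiator, bracket_S_S, bracket_S_C, bracket_C_S, h.eq, map_neg,
    LinearMap.neg_apply, TensorProduct.tmul_sub, map_sub]
  module

theorem jacobiator_S_A_A (h : D.SClosed) (d : S) (x y : Sl F V) (a b : A) :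
    jacobiator (D.bracket vol) (ιS d) (ιA (x ⊗ₜ a)) (ιA (y ⊗ₜ b)) =
      ιA (traceless (x.1 * y.1) ⊗ₜ
        (D.mulA (D.sA d a) b + D.mulA a (D.sA d b) - D.sA d (D.mulA a b)))
      - ιA (traceless (y.1 * x.1) ⊗ₜ
        (D.mulA (D.sA d b) a + D.mulA b (D.sA d a) - D.sA d (D.mulA b a)))
      + slForm x y • ιS (D.dA (D.sA d a) b + D.dA a (D.sA d b) - D.brS d (D.dA a b)) := by
  -- The cyclic sum contains `[D_{a,b}, d]`, whereas invariance is stated for `[d, D_{a,b}]`.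
  have hs := D.bracket_anti vol (ιS (D.dA a b)) (ιS d)
  rw [bracket_S_S, bracket_S_S, h.eq d] at hs
  simp only [jacobiator, bracket_S_A, bracket_A_S, bracket_A_A_eq, bracket_S_S, hs, map_neg,
    LinearMap.neg_apply, TensorProduct.tmul_sub, TensorProduct.tmul_add, map_sub, map_add, map_smul,
    LinearMap.add_apply, LinearMap.sub_apply, LinearMap.smul_apply, slForm_symm y x]
  rw [D.dA_skew (D.sA d b) a, map_neg]
  module

theorem jacobiator_S_A_B (d : S) (x : Sl F V) (u : V) (a : A) (b : B) :
    jacobiator (D.bracket vol) (ιS d) (ιA (x ⊗ₜ a)) (ιB (u ⊗ₜ b)) =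
      ιB (x.1 u ⊗ₜ
        (D.actB (D.sA d a) b + D.actB a (D.sB d b) - D.sB d (D.actB a b))) := by
  simp only [jacobiator, bracket_S_A, bracket_A_B, bracket_B_S, bracket_B_A, map_neg,
    LinearMap.neg_apply, TensorProduct.tmul_sub, TensorProduct.tmul_add, map_sub, map_add]
  module

theorem jacobiator_S_A_C (d : S) (x : Sl F V) (f : Module.Dual F V) (a : A) (c : C) :
    jacobiator (D.bracket vol) (ιS d) (ιA (x ⊗ₜ a)) (ιC (f ⊗ₜ c)) =
      -ιC ((f ∘ₗ x.1) ⊗ₜ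
        (D.actC (D.sC d c) a + D.actC c (D.sA d a) - D.sC d (D.actC c a))) := by
  simp only [jacobiator, bracket_S_A, bracket_A_C, bracket_C_S, bracket_C_A, map_neg,
    LinearMap.neg_apply, TensorProduct.tmul_sub, TensorProduct.tmul_add, map_sub, map_add]
  module

theorem jacobiator_S_B_B (d : S) (u v : V) (m n : B) :
    jacobiator (D.bracket vol) (ιS d) (ιB (u ⊗ₜ m)) (ιB (v ⊗ₜ n)) =
      ιC (wedgeForm vol u v ⊗ₜ
        (D.crossB (D.sB d m) n + D.crossB m (D.sB d n) - D.sC d (D.crossB m n))) := by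
  simp only [jacobiator, bracket_S_B, bracket_B_S, bracket_B_B, bracket_C_S, map_neg,
    LinearMap.neg_apply, TensorProduct.tmul_sub, TensorProduct.tmul_add, map_sub, map_add]
  rw [wedgeForm_anti vol v u, map_neg_tmul, D.crossB_symm (D.sB d n) m]
  module

theorem jacobiator_S_C_C (d : S) (f g : Module.Dual F V) (c k : C) :
    jacobiator (D.bracket vol) (ιS d) (ιC (f ⊗ₜ c)) (ιC (g ⊗ₜ k)) =
      ιB (wedgeDual vol f g ⊗ₜ
        (D.crossC (D.sC d c) k + D.crossC c (D.sC d k) - D.sB d (D.crossC c k))) := by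
  simp only [jacobiator, bracket_S_C, bracket_C_S, bracket_C_C, bracket_B_S, map_neg,
    LinearMap.neg_apply, TensorProduct.tmul_sub, TensorProduct.tmul_add, map_sub, map_add]
  rw [wedgeDual_anti vol g f, map_neg_tmul, D.crossC_symm (D.sC d k) c]
  module

theorem jacobiator_S_B_C (h : D.SClosed) (d : S) (u : V) (f : Module.Dual F V) (b : B) (c : C) :
    jacobiator (D.bracket vol) (ιS d) (ιB (u ⊗ₜ b)) (ιC (f ⊗ₜ c)) =
      ιA (rankOne u f ⊗ₜ (D.t (D.sB d b) c + D.t b (D.sC d c) - D.sA d (D.t b c)))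
      + ((3 : F)⁻¹ * f u) •
        ιS (D.dBC (D.sB d b) c + D.dBC b (D.sC d c) - D.brS d (D.dBC b c)) := by
  have hs := D.bracket_anti vol (ιS (D.dBC b c)) (ιS d)
  rw [bracket_S_S, bracket_S_S, h.eq d] at hs
  simp only [jacobiator, bracket_S_B, bracket_C_S, bracket_B_C, bracket_C_B, bracket_A_S,
    bracket_S_S, hs, map_neg,
    LinearMap.neg_apply, TensorProduct.tmul_sub, TensorProduct.tmul_add, map_sub, map_add, map_smul,
    LinearMap.add_apply, LinearMap.smul_apply]
  module

end BracketData
-- The traceless part discards the scalar term of the Cayley–Hamilton identity.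
theorem traceless_sum_perm {F V : Type*} [Field F] [AddCommGroup V] [Module F V]
    [Fact (Module.finrank F V = 3)] [NeZero (3 : F)] (x y z : Sl F V) :
    traceless (x.1 * y.1 * z.1) + traceless (y.1 * z.1 * x.1) + traceless (z.1 * x.1 * y.1)
      + traceless (x.1 * z.1 * y.1) + traceless (z.1 * y.1 * x.1) + traceless (y.1 * x.1 * z.1) =
    (3 * slForm x y) • z + (3 * slForm y z) • x + (3 * slForm z x) • y := by
  simp only [← map_add]
  rw [sum_perm_mul (trace_coe x) (trace_coe y) (trace_coe z)]
  simp only [map_add, map_smul, traceless_coe, traceless_one, smul_zero, add_zero, slForm_apply,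
    mul_inv_cancel_left₀ (NeZero.ne (3 : F))]

namespace BracketData

variable {F V A B C S : Type*} [Field F] [AddCommGroup V] [Module F V]
  [AddCommGroup A] [Module F A] [AddCommGroup B] [Module F B]
  [AddCommGroup C] [Module F C] [AddCommGroup S] [Module F S]
  {D : BracketData F V A B C S}

/-! ### Consequences of the conditions -/

/-- Linearization of the left alternative law at `a + b`. -/
theorem Cond1.assocA_swap_left (h : D.Cond1) (a b c : A) :
    D.assocA b a c = -D.assocA a b c := by
  have h1 := h.left_alternative (a + b) c
  have h2 := h.left_alternative a c
  have h3 := h.left_alternative b c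
  simp only [map_add, LinearMap.add_apply, h2, h3] at h1
  simp only [assocA]
  linear_combination (norm := module) h1

theorem Cond1.assocA_swap_right (h : D.Cond1) (a b c : A) :
    D.assocA a c b = -D.assocA a b c := by
  have h1 := h.right_alternative (b + c) a
  have h2 := h.right_alternative b a
  have h3 := h.right_alternative c a
  simp only [map_add, LinearMap.add_apply, h2, h3] at h1
  simp only [assocA]
  linear_combination (norm := module) h1

theorem Cond1.defectA_eq [NeZero (2 : F)] (h : D.Cond1) (a b c : A) :
    D.defectA a b c = -((3 : F) • D.assocA a b c) := by
  have h1 := h.dA_apply a b c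
  have h2 := h.assocA_swap_right a b c
  simp only [comm_eq, assocA, defectA, map_sub, LinearMap.sub_apply] at h1 h2 ⊢
  linear_combination (norm := module) h1 + (3 : F) • h2

theorem Cond1.dA_mul_sum (h : D.Cond1) (a b c : A) :
    D.dA (D.mulA a b) c + D.dA (D.mulA b c) a + D.dA (D.mulA c a) b = 0 := by
  have h1 := h.dA_cyclic a b c
  rw [D.dA_skew a, D.dA_skew b, D.dA_skew c] at h1
  linear_combination (norm := module) -h1

/-- Full polarization of the cubic map `b ↦ D_{b, b × b}`. As `×` is symmetric, each of the three
terms appears twice, and the factor 2 is invertible. -/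
theorem Cond5.dB_sum [h2 : NeZero (2 : F)] (h : D.Cond5) (m n p : B) :
    D.dBC p (D.crossB m n) + D.dBC m (D.crossB n p) + D.dBC n (D.crossB p m) = 0 := by
  have h1 := h.dB (m + n + p)
  have a1 := h.dB (m + n)
  have a2 := h.dB (n + p)
  have a3 := h.dB (m + p)
  have b1 := h.dB m
  have b2 := h.dB n
  have b3 := h.dB p
  simp only [map_add, LinearMap.add_apply, D.crossB_symm n m, D.crossB_symm p n,
    D.crossB_symm p m] at h1 a1 a2 a3 ⊢
  refine (smul_eq_zero_iff_right h2.out).1 ?_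
  linear_combination (norm := module) h1 - a1 - a2 - a3 + b1 + b2 + b3

theorem Cond5.dC_sum [h2 : NeZero (2 : F)] (h : D.Cond5) (m n p : C) :
    D.dBC (D.crossC m n) p + D.dBC (D.crossC n p) m + D.dBC (D.crossC p m) n = 0 := by
  have h1 := h.dC (m + n + p)
  have a1 := h.dC (m + n)
  have a2 := h.dC (n + p)
  have a3 := h.dC (m + p)
  have b1 := h.dC m
  have b2 := h.dC n
  have b3 := h.dC p
  simp only [map_add, LinearMap.add_apply, D.crossC_symm n m, D.crossC_symm p n,
    D.crossC_symm p m] at h1 a1 a2 a3 ⊢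
  refine (smul_eq_zero_iff_right h2.out).1 ?_
  linear_combination (norm := module) h1 - a1 - a2 - a3 + b1 + b2 + b3

theorem Cond0.inv_mulA (h : D.Cond0) (d : S) (a b : A) :
    D.sA d (D.mulA a b) = D.mulA (D.sA d a) b + D.mulA a (D.sA d b) := by
  simp only [mulA_apply, map_add, map_smul, h.inv_circ, h.inv_comm]
  module

variable [hV : Fact (Module.finrank F V = 3)] [NeZero (2 : F)] [NeZero (3 : F)]
  (vol : V [⋀^Fin 3]→ₗ[F] F)

local notation "ιA" => inA F V A B C S
local notation "ιB" => inB F V A B C S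
local notation "ιC" => inC F V A B C S
local notation "ιS" => inS F V A B C S

/-! ### The Jacobi identity from the conditions -/

/-- With all associators expressed through that of `a, b, c`, the six words add up with equal sign.
Their sum is cancelled by the three terms with `defectA = -3 assocA`, by Cayley–Hamilton. -/
theorem Cond1.jacobiator_A_A_A (h : D.Cond1) (x y z : Sl F V) (a b c : A) :
    jacobiator (D.bracket vol) (ιA (x ⊗ₜ a)) (ιA (y ⊗ₜ b)) (ιA (z ⊗ₜ c)) = 0 := by
  have e1 : D.assocA b c a = D.assocA a b c := by
    rw [h.assocA_swap_right, h.assocA_swap_left, neg_neg]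
  have e2 : D.assocA c a b = D.assocA a b c := by
    rw [h.assocA_swap_left, h.assocA_swap_right, neg_neg]
  rw [BracketData.jacobiator_A_A_A, h.defectA_eq, h.defectA_eq, h.defectA_eq, h.dA_mul_sum,
    D.dA_skew (D.mulA b a), D.dA_skew (D.mulA c b), D.dA_skew (D.mulA a c),
    h.assocA_swap_left b c a, h.assocA_swap_right a b c, h.assocA_swap_left a b c, e1, e2]
  have hc := h.dA_cyclic a c b
  have hs : -D.dA c (D.mulA b a) + -D.dA a (D.mulA c b) + -D.dA b (D.mulA a c) = 0 := by
    linear_combination (norm := module) -hc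
  rw [hs]
  have key := congrArg (fun s => ιA (s ⊗ₜ D.assocA a b c)) (traceless_sum_perm x y z)
  simp only [TensorProduct.add_tmul, ← TensorProduct.smul_tmul', map_add, map_smul] at key
  simp only [map_tmul_neg, TensorProduct.tmul_smul, map_smul, map_zero, smul_zero]
  linear_combination (norm := module) key

theorem Cond2.jacobiator_A_A_B (h : D.Cond2) (x y : Sl F V) (u : V) (a b : A) (m : B) :
    jacobiator (D.bracket vol) (ιA (x ⊗ₜ a)) (ιA (y ⊗ₜ b)) (ιB (u ⊗ₜ m)) = 0 := by
  rw [BracketData.jacobiator_A_A_B]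
  simp [h.assocB, h.dA_B, comm_eq]

theorem Cond2.jacobiator_A_A_C (h : D.Cond2) (x y : Sl F V) (f : Module.Dual F V) (a b : A)
    (c : C) :
    jacobiator (D.bracket vol) (ιA (x ⊗ₜ a)) (ιA (y ⊗ₜ b)) (ιC (f ⊗ₜ c)) = 0 := by
  rw [BracketData.jacobiator_A_A_C]
  simp [h.assocC, h.dA_C, comm_eq]

omit [NeZero (2 : F)] in
-- The three second factors coincide, and the first factors add up to the derivative of the volume
-- form along the traceless `x`.
theorem Cond4.jacobiator_A_B_B (h : D.Cond4) (x : Sl F V) (u v : V) (a : A) (m n : B) :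
    jacobiator (D.bracket vol) (ιA (x ⊗ₜ a)) (ιB (u ⊗ₜ m)) (ιB (v ⊗ₜ n)) = 0 := by
  rw [BracketData.jacobiator_A_B_B, ← h.crossB_left, ← h.crossB_right, ← map_add, ← map_add,
    ← TensorProduct.add_tmul, ← TensorProduct.add_tmul]
  have hw : wedgeForm vol (x.1 u) v + wedgeForm vol u (x.1 v) + wedgeForm vol u v ∘ₗ x.1 = 0 := by
    ext w
    have := vol_end_add vol x.1 u v w
    rw [trace_coe, zero_mul] at this
    exact this
  rw [hw, TensorProduct.zero_tmul, map_zero]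

omit [NeZero (2 : F)] in
theorem Cond4.jacobiator_A_C_C (h : D.Cond4) (hvol : vol ≠ 0) (x : Sl F V)
    (f g : Module.Dual F V) (a : A) (c d : C) :
    jacobiator (D.bracket vol) (ιA (x ⊗ₜ a)) (ιC (f ⊗ₜ c)) (ιC (g ⊗ₜ d)) = 0 := by
  have hw : wedgeDual vol (f ∘ₗ x.1) g + wedgeDual vol f (g ∘ₗ x.1) + x.1 (wedgeDual vol f g)
      = 0 := by
    obtain ⟨e⟩ := exists_basis F V
    refine coord_ext e fun i => ?_
    have := dualForm_end_add vol hvol x.1 f g (e.coord i)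
    rw [trace_coe, zero_mul, ← apply_wedgeDual, ← apply_wedgeDual, ← apply_wedgeDual] at this
    simpa using this
  rw [BracketData.jacobiator_A_C_C, ← h.crossC_left, ← h.crossC_right]
  have := congrArg (fun s => ιB (s ⊗ₜ D.actB a (D.crossC c d))) hw
  simp only [TensorProduct.add_tmul, map_add, TensorProduct.zero_tmul, map_zero] at this
  linear_combination (norm := module) -this

theorem Cond3.jacobiator_A_B_C (h : D.Cond3) (x : Sl F V) (u : V) (f : Module.Dual F V)
    (a : A) (m : B) (c : C) :
    jacobiator (D.bracket vol) (ιA (x ⊗ₜ a)) (ιB (u ⊗ₜ m)) (ιC (f ⊗ₜ c)) = 0 := by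
  rw [BracketData.jacobiator_A_B_C]
  simp [h.t_left, h.t_right, h.dA_t, h.dBC_apply, comm_eq]

theorem Cond5.jacobiator_B_B_B (h : D.Cond5) (u v w : V) (m n p : B) :
    jacobiator (D.bracket vol) (ιB (u ⊗ₜ m)) (ιB (v ⊗ₜ n)) (ιB (w ⊗ₜ p)) = 0 := by
  have hr : rankOne w (wedgeForm vol u v) + rankOne u (wedgeForm vol v w)
      + rankOne v (wedgeForm vol w u) = 0 := by
    -- By Cramer's rule the sum is a scalar endomorphism, so its traceless part is zero.
    have h1 : (wedgeForm vol u v).smulRight w + (wedgeForm vol v w).smulRight u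
        + (wedgeForm vol w u).smulRight v = vol ![u, v, w] • (1 : Module.End F V) := by
      ext z
      exact vol_smul_add vol u v w z
    rw [rankOne_eq, rankOne_eq, rankOne_eq, ← map_add, ← map_add, h1, map_smul, traceless_one,
      smul_zero]
  have e1 : D.t m (D.crossB n p) = D.t p (D.crossB m n) := by
    rw [D.crossB_symm, h.tB_swap₁₂]
  have e2 : D.t n (D.crossB p m) = D.t p (D.crossB m n) := by
    rw [h.tB_swap₁₂, D.crossB_symm]
  rw [BracketData.jacobiator_B_B_B, h.dB_sum, e1, e2]
  have := congrArg (fun s => ιA (s ⊗ₜ D.t p (D.crossB m n))) hr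
  simp only [TensorProduct.add_tmul, map_add, TensorProduct.zero_tmul, map_zero] at this
  rw [map_zero, smul_zero]
  linear_combination (norm := module) -this

theorem Cond5.jacobiator_C_C_C (h : D.Cond5) (hvol : vol ≠ 0) (f g k : Module.Dual F V)
    (m n p : C) :
    jacobiator (D.bracket vol) (ιC (f ⊗ₜ m)) (ιC (g ⊗ₜ n)) (ιC (k ⊗ₜ p)) = 0 := by
  have hr : rankOne (wedgeDual vol f g) k + rankOne (wedgeDual vol g k) f
      + rankOne (wedgeDual vol k f) g = 0 := by
    have h1 : k.smulRight (wedgeDual vol f g) + f.smulRight (wedgeDual vol g k)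
        + g.smulRight (wedgeDual vol k f) = dualForm vol ![f, g, k] • (1 : Module.End F V) := by
      obtain ⟨e⟩ := exists_basis F V
      refine end_ext e fun i j => ?_
      have := congrArg (fun s => s (e j)) (dualForm_smul_add vol hvol f g k (e.coord i))
      simp only [← apply_wedgeDual, LinearMap.add_apply, LinearMap.smul_apply, smul_eq_mul,
        map_add, map_smul, LinearMap.smulRight_apply, Module.End.one_apply] at this ⊢
      linear_combination this
    rw [rankOne_eq, rankOne_eq, rankOne_eq, ← map_add, ← map_add, h1, map_smul, traceless_one,
      smul_zero]
  have e1 : D.t (D.crossC n p) m = D.t (D.crossC m n) p := by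
    rw [h.tC_swap₂₃, D.crossC_symm]
  have e2 : D.t (D.crossC p m) n = D.t (D.crossC m n) p := by
    rw [D.crossC_symm, h.tC_swap₂₃]
  rw [BracketData.jacobiator_C_C_C, h.dC_sum, e1, e2]
  have := congrArg (fun s => ιA (s ⊗ₜ D.t (D.crossC m n) p)) hr
  simp only [TensorProduct.add_tmul, map_add, TensorProduct.zero_tmul, map_zero] at this
  rw [map_zero, smul_zero]
  linear_combination (norm := module) this

omit [NeZero (2 : F)] in
theorem Cond6.jacobiator_B_B_C (h : D.Cond6) (hvol : vol ≠ 0) (u v : V) (f : Module.Dual F V)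
    (m n : B) (c : C) :
    jacobiator (D.bracket vol) (ιB (u ⊗ₜ m)) (ιB (v ⊗ₜ n)) (ιC (f ⊗ₜ c)) = 0 := by
  have key : ∀ m n, D.crossC (D.crossB m n) c + D.actB (D.t n c) m
      + (3 : F)⁻¹ • D.actB (D.t m c) n - (3 : F)⁻¹ • D.sB (D.dBC m c) n = 0 := fun m n => by
    rw [h.crossB_cross, one_div]; module
  rw [BracketData.jacobiator_B_B_C D vol hvol, key, key]
  simp

omit [NeZero (2 : F)] in
theorem Cond6.jacobiator_B_C_C (h : D.Cond6) (hvol : vol ≠ 0) (u : V) (f g : Module.Dual F V)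
    (m : B) (c d : C) :
    jacobiator (D.bracket vol) (ιB (u ⊗ₜ m)) (ιC (f ⊗ₜ c)) (ιC (g ⊗ₜ d)) = 0 := by
  have key : ∀ c d, D.crossB m (D.crossC c d) + D.actC d (D.t m c)
      + (3 : F)⁻¹ • D.actC c (D.t m d) + (3 : F)⁻¹ • D.sC (D.dBC m d) c = 0 := fun c d => by
    rw [h.cross_crossC, one_div]; module
  rw [BracketData.jacobiator_B_C_C D vol hvol, key, key]
  simp

theorem isLieBracket_of_conds (hvol : vol ≠ 0) (h0 : D.Cond0) (h1 : D.Cond1) (h2 : D.Cond2)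
    (h3 : D.Cond3) (h4 : D.Cond4) (h5 : D.Cond5) (h6 : D.Cond6) :
    IsLieBracket (D.bracket vol) := by
  refine ⟨D.bracket_self vol, jacobiator_eq_zero_of_sorted _ span_generators
    (D.bracket_anti vol) ?_⟩
  intro i j k hij hjk
  -- Unsorted index triples contradict `hij` or `hjk`; the twenty sorted ones remain, in the order
  -- `S`, `A`, `B`, `C`.
  fin_cases i <;> fin_cases j <;> (try (exfalso; revert hij; decide)) <;> fin_cases k <;>
    (try (exfalso; revert hjk; decide)) <;>
    rintro _ ⟨p, rfl⟩ _ ⟨q, rfl⟩ _ ⟨r, rfl⟩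
  · rw [jacobiator_S_S_S D vol h0.closed, h0.jacobi, map_zero]
  · rw [jacobiator_S_S_A D vol h0.closed, h0.moduleA]; simp
  · rw [jacobiator_S_S_B D vol h0.closed, h0.moduleB]; simp
  · rw [jacobiator_S_S_C D vol h0.closed, h0.moduleC]; simp
  · rw [jacobiator_S_A_A D vol h0.closed, h0.inv_mulA, h0.inv_mulA, h0.inv_dA]
    simp [add_comm]
  · rw [jacobiator_S_A_B, h0.inv_actB]; simp
  · rw [jacobiator_S_A_C, h0.inv_actC]; simp
  · rw [jacobiator_S_B_B, h0.inv_crossB]; simp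
  · rw [jacobiator_S_B_C D vol h0.closed, h0.inv_t, h0.inv_dBC]; simp
  · rw [jacobiator_S_C_C, h0.inv_crossC]; simp
  · exact h1.jacobiator_A_A_A vol ..
  · exact h2.jacobiator_A_A_B vol ..
  · exact h2.jacobiator_A_A_C vol ..
  · exact h4.jacobiator_A_B_B vol ..
  · exact h3.jacobiator_A_B_C vol ..
  · exact h4.jacobiator_A_C_C vol hvol ..
  · exact h5.jacobiator_B_B_B vol ..
  · exact h6.jacobiator_B_B_C vol hvol ..
  · exact h6.jacobiator_B_C_C vol hvol ..
  · exact h5.jacobiator_C_C_C vol hvol ..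

end BracketData
/-! ### Matrix units -/

section MatrixUnits

variable {F V : Type*} [Field F] [AddCommGroup V] [Module F V] (e : Module.Basis (Fin 3) F V)

/-- The matrix unit with entry `1` in the position `(i, j)`, for `i ≠ j`. -/
def unit (i j : Fin 3) (h : i ≠ j) : Sl F V :=
  ⟨(e.coord j).smulRight (e i), by
    have := Module.Finite.of_basis e
    rw [LinearMap.mem_ker, LinearMap.trace_smulRight, coord_basis, if_neg h]⟩

@[simp] theorem unit_apply (i j : Fin 3) (h : i ≠ j) (v : V) :
    (unit e i j h).1 v = e.coord j v • e i := rfl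

/-- The diagonal matrix with entries `1` and `-1` in the positions `i` and `j`. -/
def diagUnit (i j : Fin 3) : Sl F V :=
  ⟨(e.coord i).smulRight (e i) - (e.coord j).smulRight (e j), by
    have := Module.Finite.of_basis e
    rw [LinearMap.mem_ker, map_sub, LinearMap.trace_smulRight, LinearMap.trace_smulRight,
      coord_basis, coord_basis, if_pos rfl, if_pos rfl, sub_self]⟩

@[simp] theorem diagUnit_apply (i j : Fin 3) (v : V) :
    (diagUnit e i j).1 v = e.coord i v • e i - e.coord j v • e j := rfl

/-- The matrix entry in the position `(i, j)`. -/
def entry (i j : Fin 3) : Module.Dual F (Sl F V) :=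
  e.coord i ∘ₗ LinearMap.applyₗ (e j) ∘ₗ Submodule.subtype _

theorem entry_apply (i j : Fin 3) (x : Sl F V) : entry e i j x = e.coord i (x.1 (e j)) := rfl

theorem entry_unit (i j k l : Fin 3) (h : k ≠ l) :
    entry e i j (unit e k l h) = (if j = l then 1 else 0) * (if k = i then 1 else 0) := by
  rw [entry_apply, unit_apply, map_smul, coord_basis, coord_basis, smul_eq_mul]

theorem slForm_eq_sum (x y : Sl F V) : slForm x y = (3 : F)⁻¹ *
    (e.coord 0 (x.1 (y.1 (e 0))) + e.coord 1 (x.1 (y.1 (e 1))) + e.coord 2 (x.1 (y.1 (e 2)))) := by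
  rw [slForm_apply, trace_eq_sum e]; rfl

variable [Fact (Module.finrank F V = 3)]

theorem dualForm_apply {vol : V [⋀^Fin 3]→ₗ[F] F} (hvol : vol ≠ 0) (f g h : Module.Dual F V) :
    dualForm vol ![f, g, h] = (vol e)⁻¹ *
      (f (e 0) * g (e 1) * h (e 2) - f (e 0) * g (e 2) * h (e 1) - f (e 1) * g (e 0) * h (e 2)
        + f (e 1) * g (e 2) * h (e 0) + f (e 2) * g (e 0) * h (e 1)
        - f (e 2) * g (e 1) * h (e 0)) := by
  rw [← dualForm_mul_basis vol e hvol, mul_comm,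
    mul_inv_cancel_right₀ (vol_basis_ne_zero vol e hvol)]

variable [NeZero (3 : F)]

theorem entry_traceless (i j : Fin 3) (x : Module.End F V) :
    entry e i j (traceless x) = e.coord i (x (e j))
      - (3 : F)⁻¹ * LinearMap.trace F V x * (if j = i then 1 else 0) := by
  rw [entry_apply, coe_traceless, LinearMap.sub_apply, map_sub, LinearMap.smul_apply, map_smul,
    Module.End.one_apply, coord_basis, smul_eq_mul]

theorem entry_rankOne (i j : Fin 3) (u : V) (f : Module.Dual F V) :
    entry e i j (rankOne u f) = f (e j) * e.coord i u
      - (3 : F)⁻¹ * f u * (if j = i then 1 else 0) := by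
  have := Module.Finite.of_basis e
  rw [rankOne_eq, entry_traceless, LinearMap.trace_smulRight, LinearMap.smulRight_apply, map_smul,
    smul_eq_mul]

end MatrixUnits

namespace BracketData

variable {F V A B C S : Type*} [Field F] [AddCommGroup V] [Module F V]
  [AddCommGroup A] [Module F A] [AddCommGroup B] [Module F B]
  [AddCommGroup C] [Module F C] [AddCommGroup S] [Module F S]
  {D : BracketData F V A B C S}
  [hV : Fact (Module.finrank F V = 3)] [h2 : NeZero (2 : F)] [h3 : NeZero (3 : F)]
  {vol : V [⋀^Fin 3]→ₗ[F] F}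

/-! ### The conditions from the Jacobi identity -/

theorem cond2_of_jacobi (hJ : ∀ x y z, jacobiator (D.bracket vol) x y z = 0) : D.Cond2 := by
  obtain ⟨e⟩ := exists_basis F V
  refine ⟨fun a b m => ?_, fun c a b => ?_, fun a b m => ?_, fun a b c => ?_⟩
  -- `E₀₁ E₁₂ e₂ = e₀`, while `E₀₁ e₂ = 0` and `tr(E₀₁ E₁₂) = 0`, so only the first term survives.
  · have h := hJ (inA F V A B C S (unit e 0 1 (by decide) ⊗ₜ a))
      (inA F V A B C S (unit e 1 2 (by decide) ⊗ₜ b)) (inB F V A B C S (e 2 ⊗ₜ m))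
    rw [jacobiator_A_A_B] at h
    have h := congrArg (coefB (e.coord 0)) h
    simp [slForm_eq_sum e] at h
    exact (sub_eq_zero.1 h).symm
  · have h := hJ (inA F V A B C S (unit e 0 1 (by decide) ⊗ₜ a))
      (inA F V A B C S (unit e 1 2 (by decide) ⊗ₜ b)) (inC F V A B C S (e.coord 0 ⊗ₜ c))
    rw [jacobiator_A_A_C] at h
    have h := congrArg (coefC (Module.Dual.eval F V (e 2))) h
    simp [slForm_eq_sum e] at h
    exact sub_eq_zero.1 h
  -- Both `E₀₁` and `E₁₀` annihilate `e₂`, but the trace of their product is 1: only the term with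
  -- `D_{a,b}` remains.
  · have h := hJ (inA F V A B C S (unit e 0 1 (by decide) ⊗ₜ a))
      (inA F V A B C S (unit e 1 0 (by decide) ⊗ₜ b)) (inB F V A B C S (e 2 ⊗ₜ m))
    rw [jacobiator_A_A_B] at h
    have h := congrArg (coefB (e.coord 2)) h
    simp [slForm_eq_sum e, h3.out] at h
    rw [sub_eq_zero.1 h, comm_eq]
    simp
  · have h := hJ (inA F V A B C S (unit e 0 1 (by decide) ⊗ₜ a))
      (inA F V A B C S (unit e 1 0 (by decide) ⊗ₜ b)) (inC F V A B C S (e.coord 2 ⊗ₜ c))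
    rw [jacobiator_A_A_C] at h
    have h := congrArg (coefC (Module.Dual.eval F V (e 2))) h
    simp [slForm_eq_sum e, h3.out] at h
    rw [sub_eq_zero.1 h, comm_eq]
    simp

theorem cond3_of_jacobi (hJ : ∀ x y z, jacobiator (D.bracket vol) x y z = 0) : D.Cond3 := by
  obtain ⟨e⟩ := exists_basis F V
  refine ⟨fun a m c => ?_, fun a m c => ?_, fun a m c => ?_, fun a m c => ?_⟩
  · have h := hJ (inA F V A B C S (unit e 0 1 (by decide) ⊗ₜ a))
      (inB F V A B C S (e 1 ⊗ₜ m)) (inC F V A B C S (e.coord 2 ⊗ₜ c))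
    rw [jacobiator_A_B_C] at h
    have h := congrArg (coefA (entry e 0 2)) h
    simp [entry_traceless, trace_eq_sum e] at h
    exact (sub_eq_zero.1 h).symm
  · have h := hJ (inA F V A B C S (unit e 0 1 (by decide) ⊗ₜ a))
      (inB F V A B C S (e 2 ⊗ₜ m)) (inC F V A B C S (e.coord 0 ⊗ₜ c))
    rw [jacobiator_A_B_C] at h
    have h := congrArg (coefA (entry e 2 1)) h
    simp [entry_traceless, trace_eq_sum e] at h
    exact (sub_eq_zero.1 h)
  · have h := hJ (inA F V A B C S (unit e 0 1 (by decide) ⊗ₜ a))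
      (inB F V A B C S (e 1 ⊗ₜ m)) (inC F V A B C S (e.coord 0 ⊗ₜ c))
    rw [jacobiator_A_B_C] at h
    have h := congrArg (prS F V A B C S) h
    simp [h3.out] at h
    exact (sub_eq_zero.1 h).symm
  -- Here `x u = 0` and `f x = 0` but `f(u) = 1`, which isolates the action of `D_{b,c}` on `a`.
  · have h := hJ (inA F V A B C S (unit e 0 1 (by decide) ⊗ₜ a))
      (inB F V A B C S (e 2 ⊗ₜ m)) (inC F V A B C S (e.coord 2 ⊗ₜ c))
    rw [jacobiator_A_B_C] at h
    have h := congrArg (coefA (entry e 0 1)) h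
    simp [entry_traceless, entry_unit, trace_eq_sum e, h3.out] at h
    rw [sub_eq_zero.1 h, comm_eq]

omit h2 in
theorem cond4_of_jacobi (hvol : vol ≠ 0) (hJ : ∀ x y z, jacobiator (D.bracket vol) x y z = 0) :
    D.Cond4 := by
  obtain ⟨e⟩ := exists_basis F V
  have hv := vol_basis_ne_zero vol e hvol
  have hv' := inv_ne_zero hv
  -- With `u = v = e₁` the third term contains `e₁ ∧ e₁ = 0`, and the first two have opposite
  -- wedges.
  have hB : ∀ a m n, D.crossB (D.actB a m) n = D.crossB m (D.actB a n) := fun a m n => by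
    have h := hJ (inA F V A B C S (unit e 0 1 (by decide) ⊗ₜ a))
      (inB F V A B C S (e 1 ⊗ₜ m)) (inB F V A B C S (e 1 ⊗ₜ n))
    rw [jacobiator_A_B_B] at h
    have h := congrArg (coefC (Module.Dual.eval F V (e 2))) h
    simp [wedgeForm_apply, vol_apply e] at h
    exact sub_eq_zero.1 ((smul_eq_zero_iff_right hv).1 (by linear_combination (norm := module) h))
  -- With `v = e₂` the middle term vanishes because `E₀₁ e₂ = 0`.
  have hB' : ∀ a m n, D.actC (D.crossB m n) a = D.crossB (D.actB a m) n := fun a m n => by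
    have h := hJ (inA F V A B C S (unit e 0 1 (by decide) ⊗ₜ a))
      (inB F V A B C S (e 1 ⊗ₜ m)) (inB F V A B C S (e 2 ⊗ₜ n))
    rw [jacobiator_A_B_B] at h
    have h := congrArg (coefC (Module.Dual.eval F V (e 1))) h
    simp [wedgeForm_apply, vol_apply e] at h
    exact sub_eq_zero.1 ((smul_eq_zero_iff_right hv).1 (by linear_combination (norm := module) h))
  have hC : ∀ a m n, D.crossC (D.actC m a) n = D.crossC m (D.actC n a) := fun a m n => by
    have h := hJ (inA F V A B C S (unit e 0 1 (by decide) ⊗ₜ a))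
      (inC F V A B C S (e.coord 0 ⊗ₜ m)) (inC F V A B C S (e.coord 0 ⊗ₜ n))
    rw [jacobiator_A_C_C] at h
    have h := congrArg (coefB (e.coord 2)) h
    simp only [map_neg, map_sub, coefB_inB, unit_apply, map_smul, apply_wedgeDual,
      dualForm_apply e hvol] at h
    simp at h
    exact sub_eq_zero.1 ((smul_eq_zero_iff_right hv').1
      (by linear_combination (norm := module) h))
  have hC' : ∀ a m n, D.actB a (D.crossC m n) = D.crossC (D.actC m a) n := fun a m n => by
    have h := hJ (inA F V A B C S (unit e 0 1 (by decide) ⊗ₜ a))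
      (inC F V A B C S (e.coord 0 ⊗ₜ m)) (inC F V A B C S (e.coord 2 ⊗ₜ n))
    rw [jacobiator_A_C_C] at h
    have h := congrArg (coefB (e.coord 0)) h
    simp only [map_neg, map_sub, coefB_inB, unit_apply, map_smul, apply_wedgeDual,
      dualForm_apply e hvol] at h
    simp at h
    exact sub_eq_zero.1 ((smul_eq_zero_iff_right hv').1
      (by linear_combination (norm := module) h))
  exact ⟨hB', fun a m n => (hB' a m n).trans (hB a m n), hC',
    fun a m n => (hC' a m n).trans (hC a m n)⟩

omit h2 in
theorem cond5_of_jacobi (hvol : vol ≠ 0) (hJ : ∀ x y z, jacobiator (D.bracket vol) x y z = 0) :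
    D.Cond5 := by
  obtain ⟨e⟩ := exists_basis F V
  have hv := vol_basis_ne_zero vol e hvol
  have hv' := inv_ne_zero hv
  refine ⟨fun m => ?_, fun m => ?_, fun m n p => ?_, fun m n p => by rw [D.crossB_symm],
    fun m n p => by rw [D.crossC_symm], fun m n p => ?_⟩
  -- Equal second factors make the three `D` terms coincide, so the `S`-component is a nonzero
  -- multiple of `3 D_{m, m × m}`.
  · have h := hJ (inB F V A B C S (e 0 ⊗ₜ m)) (inB F V A B C S (e 1 ⊗ₜ m))
      (inB F V A B C S (e 2 ⊗ₜ m))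
    rw [jacobiator_B_B_B] at h
    have h := congrArg (prS F V A B C S) h
    simp [vol_apply e] at h
    exact (smul_eq_zero_iff_right h3.out).1 ((smul_eq_zero_iff_right (mul_ne_zero
      (inv_ne_zero h3.out) hv)).1 (by linear_combination (norm := module) -h))
  · have h := hJ (inC F V A B C S (e.coord 0 ⊗ₜ m)) (inC F V A B C S (e.coord 1 ⊗ₜ m))
      (inC F V A B C S (e.coord 2 ⊗ₜ m))
    rw [jacobiator_C_C_C] at h
    have h := congrArg (prS F V A B C S) h
    simp [dualForm_apply e hvol] at h
    exact (smul_eq_zero_iff_right h3.out).1 ((smul_eq_zero_iff_right (mul_ne_zero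
      (inv_ne_zero h3.out) hv')).1 (by linear_combination (norm := module) h))
  -- Since the outer vectors coincide, `w ∧ u = 0` and the two other wedges are opposite.
  · have h := hJ (inB F V A B C S (e 0 ⊗ₜ n)) (inB F V A B C S (e 1 ⊗ₜ p))
      (inB F V A B C S (e 0 ⊗ₜ m))
    rw [jacobiator_B_B_B] at h
    have h := congrArg (coefA (entry e 0 2)) h
    simp [entry_rankOne, wedgeForm_apply, vol_apply e] at h
    rw [D.crossB_symm m p]
    exact sub_eq_zero.1 ((smul_eq_zero_iff_right hv).1 (by linear_combination (norm := module) -h))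
  · have h := hJ (inC F V A B C S (e.coord 0 ⊗ₜ n)) (inC F V A B C S (e.coord 1 ⊗ₜ m))
      (inC F V A B C S (e.coord 0 ⊗ₜ p))
    rw [jacobiator_C_C_C] at h
    have h := congrArg (coefA (entry e 2 0)) h
    simp only [map_add, coefA_inA, coefA_inS, map_smul, entry_rankOne, apply_wedgeDual,
      dualForm_apply e hvol] at h
    simp at h
    rw [D.crossC_symm m n]
    exact sub_eq_zero.1 ((smul_eq_zero_iff_right hv').1
      (by linear_combination (norm := module) h))

omit h2 in
theorem cond6_of_jacobi (hvol : vol ≠ 0) (hJ : ∀ x y z, jacobiator (D.bracket vol) x y z = 0) :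
    D.Cond6 := by
  obtain ⟨e⟩ := exists_basis F V
  refine ⟨fun m n c => ?_, fun m c d => ?_⟩
  · have h := hJ (inB F V A B C S (e 0 ⊗ₜ m)) (inB F V A B C S (e 1 ⊗ₜ n))
      (inC F V A B C S (e.coord 0 ⊗ₜ c))
    rw [jacobiator_B_B_C D vol hvol] at h
    have h := congrArg (coefB (e.coord 1)) h
    simp at h
    rw [one_div]
    linear_combination (norm := module) h
  -- The elements `d` and `c` are placed in reverse order because the coefficient of `f(u) g` has
  -- its arguments exchanged.
  · have h := hJ (inB F V A B C S (e 0 ⊗ₜ m)) (inC F V A B C S (e.coord 0 ⊗ₜ d))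
      (inC F V A B C S (e.coord 1 ⊗ₜ c))
    rw [jacobiator_B_C_C D vol hvol] at h
    have h := congrArg (coefC (Module.Dual.eval F V (e 1))) h
    simp at h
    rw [one_div]
    linear_combination (norm := module) h

theorem cond1_of_jacobi (hJ : ∀ x y z, jacobiator (D.bracket vol) x y z = 0) : D.Cond1 := by
  obtain ⟨e⟩ := exists_basis F V
  -- Of the six words only `xyz = E₀₀`, `yzx = E₁₁` and `zxy = E₂₂` are nonzero. The difference of
  -- two diagonal entries ignores scalar corrections and the third word.
  have hcyc : ∀ a b c, D.assocA b c a = D.assocA a b c := fun a b c => by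
    have h := hJ (inA F V A B C S (unit e 0 1 (by decide) ⊗ₜ a))
      (inA F V A B C S (unit e 1 2 (by decide) ⊗ₜ b))
      (inA F V A B C S (unit e 2 0 (by decide) ⊗ₜ c))
    rw [jacobiator_A_A_A] at h
    have h := congrArg (coefA (entry e 0 0 - entry e 1 1)) h
    simp [slForm_eq_sum e, entry_traceless, trace_eq_sum e] at h
    linear_combination (norm := module) -h
  -- The diagonal matrix `E₁₁ - E₂₂` gives `xyz = -E₀₂` and `xzy = E₀₂`; all other words and all
  -- pairings vanish.
  have hskew : ∀ a b c, D.assocA a c b = -D.assocA a b c := fun a b c => by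
    have h := hJ (inA F V A B C S (unit e 0 1 (by decide) ⊗ₜ a))
      (inA F V A B C S (unit e 1 2 (by decide) ⊗ₜ b))
      (inA F V A B C S (diagUnit e 1 2 ⊗ₜ c))
    rw [jacobiator_A_A_A] at h
    have h := congrArg (coefA (entry e 0 2)) h
    simp [slForm_eq_sum e, entry_traceless] at h
    linear_combination (norm := module) -h
  -- Only `xyz = E₀₂` and `(x | y) = 1/3` survive, which ties the defect to the associator.
  have hdefect : ∀ a b c, D.defectA a b c = -((3 : F) • D.assocA a b c) := fun a b c => by
    have h := hJ (inA F V A B C S (unit e 0 1 (by decide) ⊗ₜ a))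
      (inA F V A B C S (unit e 1 0 (by decide) ⊗ₜ b))
      (inA F V A B C S (unit e 0 2 (by decide) ⊗ₜ c))
    rw [jacobiator_A_A_A] at h
    have h := congrArg (coefA (entry e 0 2)) h
    simp [slForm_eq_sum e, entry_traceless, entry_unit] at h
    have h := congrArg (fun s => (3 : F) • s) h
    simp only [smul_add, smul_inv_smul₀ h3.out, smul_zero] at h
    linear_combination (norm := module) h
  have hdiag : ∀ b a, D.assocA b a a = 0 := fun b a =>
    (smul_eq_zero_iff_right h2.out).1 (by linear_combination (norm := module) hskew b a a)
  refine ⟨fun a b => ?_, fun a b => ?_, fun a b c => ?_, fun a b c => ?_⟩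
  · exact sub_eq_zero.1 ((hcyc b a a).trans (hdiag b a))
  · exact sub_eq_zero.1 (hdiag b a)
  -- The triple used for `hcyc` has `tr(xyz) = 1` and `tr(zyx) = 0`, so its `S`-component is one
  -- cyclic sum.
  · have h := hJ (inA F V A B C S (unit e 0 1 (by decide) ⊗ₜ a))
      (inA F V A B C S (unit e 1 2 (by decide) ⊗ₜ b))
      (inA F V A B C S (unit e 2 0 (by decide) ⊗ₜ c))
    rw [jacobiator_A_A_A] at h
    have h := congrArg (prS F V A B C S) h
    simp [trace_eq_sum e] at h
    have h := congrArg (fun s => (3 : F) • s) h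
    simp only [smul_add, smul_inv_smul₀ h3.out, smul_zero] at h
    rw [D.dA_skew a, D.dA_skew b, D.dA_skew c]
    linear_combination (norm := module) -h
  · have h1 := hdefect a b c
    have h2 := hskew a b c
    simp only [comm_eq, assocA, defectA, map_sub, LinearMap.sub_apply] at h1 h2 ⊢
    linear_combination (norm := module) h1 - (3 : F) • h2

end BracketData
-- Closure of `S` in the presence of a distinguished element
theorem eq_zero_of_rTensor_eq_zero {F M N ι : Type*} [Field F] [AddCommGroup M] [Module F M]
    [AddCommGroup N] [Module F N] [Fintype ι] (f g : ι → M →ₗ[F] M) {r : F} (hr : r ≠ 0)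
    (h : ∀ m, ∑ i, g i (f i m) = r • m) (z : M ⊗[F] N)
    (hz : ∀ i, LinearMap.rTensor N (f i) z = 0) : z = 0 := by
  -- The family `f` has the joint left inverse `r⁻¹ ∑ gᵢ`, and this relation persists after
  -- tensoring with `N`.
  have h' : ∑ i, g i ∘ₗ f i = r • LinearMap.id := by ext m; simpa using h m
  refine (smul_eq_zero_iff_right hr).1 ?_
  calc r • z = LinearMap.rTensor N (r • LinearMap.id) z := by
        rw [LinearMap.rTensor_smul, LinearMap.smul_apply, LinearMap.rTensor_id_apply]
    _ = ∑ i, LinearMap.rTensor N (g i ∘ₗ f i) z := by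
        rw [← h', ← LinearMap.coe_rTensorHom, map_sum, LinearMap.sum_apply]
    _ = 0 := Finset.sum_eq_zero fun i _ => by
        rw [LinearMap.rTensor_comp_apply, hz, map_zero]

namespace BracketData

variable {F V A B C S : Type*} [Field F] [AddCommGroup V] [Module F V]
  [AddCommGroup A] [Module F A] [AddCommGroup B] [Module F B]
  [AddCommGroup C] [Module F C] [AddCommGroup S] [Module F S]
  {D : BracketData F V A B C S}
  [hV : Fact (Module.finrank F V = 3)] [h2 : NeZero (2 : F)] [h3 : NeZero (3 : F)]
  {vol : V [⋀^Fin 3]→ₗ[F] F}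

/-- The 2 in the circle product with `a` cancels the 1/2 in the bracket, so `x ⊗ a` acts through `x`
on the first tensor factors alone. -/
theorem IsDistinguished.bracket_eq {a : A} (h : D.IsDistinguished a) (x : Sl F V)
    (z : Total F V A B C S) :
    D.bracket vol (inA F V A B C S (x ⊗ₜ a)) z =
      inA F V A B C S (LinearMap.rTensor A (slBracket x) (prA F V A B C S z))
      + inB F V A B C S (LinearMap.rTensor B x.1 (prB F V A B C S z))
      + inC F V A B C S (LinearMap.rTensor C (-slActDual.flip x) (prC F V A B C S z)) := by
  have hA : ∀ w, D.bracket vol (inA F V A B C S (x ⊗ₜ a)) (inA F V A B C S w) =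
      inA F V A B C S (LinearMap.rTensor A (slBracket x) w) := fun w => by
    induction w with
    | zero => simp
    | add w w' hw hw' => simp only [map_add, hw, hw']
    | tmul y b =>
      rw [bracket_A_A, h.circ, h.comm, h.dA, inv_smul_smul₀ h2.out]
      simp
  have hB : ∀ w, D.bracket vol (inA F V A B C S (x ⊗ₜ a)) (inB F V A B C S w) =
      inB F V A B C S (LinearMap.rTensor B x.1 w) := fun w => by
    induction w with
    | zero => simp
    | add w w' hw hw' => simp only [map_add, hw, hw']
    | tmul y b => rw [bracket_A_B, h.actB, LinearMap.rTensor_tmul]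
  have hC : ∀ w, D.bracket vol (inA F V A B C S (x ⊗ₜ a)) (inC F V A B C S w) =
      inC F V A B C S (LinearMap.rTensor C (-slActDual.flip x) w) := fun w => by
    induction w with
    | zero => simp
    | add w w' hw hw' => simp only [map_add, hw, hw']
    | tmul y b =>
      rw [bracket_A_C, h.actC, LinearMap.rTensor_tmul, LinearMap.neg_apply, map_neg_tmul]; rfl
  have hS : ∀ d, D.bracket vol (inA F V A B C S (x ⊗ₜ a)) (inS F V A B C S d) = 0 := fun d => by
    rw [bracket_A_S, h.sA]; simp
  conv_lhs => rw [total_eq z]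
  rw [map_add, map_add, map_add, hA, hB, hC, hS, add_zero]

theorem IsDistinguished.sClosed {a : A} (h : D.IsDistinguished a)
    (hJ : ∀ x y z, jacobiator (D.bracket vol) x y z = 0) : D.SClosed := by
  obtain ⟨e⟩ := exists_basis F V
  intro d d'
  -- In the Jacobi sum of `x ⊗ a`, `d`, `d'` the two other terms vanish because `S` annihilates `a`.
  have key : ∀ x : Sl F V, D.bracket vol (inA F V A B C S (x ⊗ₜ a)) (D.sS d d') = 0 := fun x => by
    have hx := hJ (inA F V A B C S (x ⊗ₜ a)) (inS F V A B C S d) (inS F V A B C S d')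
    rw [jacobiator, bracket_A_S, bracket_S_A, bracket_S_S, h.sA, h.sA] at hx
    rw [bracket_anti, neg_eq_zero]
    simpa using hx
  simp only [h.bracket_eq] at key
  have hne : ∀ i : Fin 3, i + 1 ≠ i := by decide
  refine mem_range_inS_of_pr_eq_zero ?_ ?_ ?_
  · let E : Fin 3 × Fin 3 → Module.End F V := fun p => (e.coord p.2).smulRight (e p.1)
    refine eq_zero_of_rTensor_eq_zero (ι := Fin 3 × Fin 3)
      (fun p => slBracket (traceless (E p)))
      (fun p => traceless ∘ₗ LinearMap.mulLeft F (E p.swap) ∘ₗ Submodule.subtype _)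
      h3.out (fun y => ?_) _
      fun p => by simpa using congrArg (prA F V A B C S) (key (traceless (E p)))
    -- `∑ E_ji E_ij = 3 I`, and `∑ E_ji y E_ij = tr(y) I = 0`.
    have hy : ∑ p : Fin 3 × Fin 3, E p.swap * (E p * y.1 - y.1 * E p) = (3 : F) • y.1 := by
      have ht := trace_coe y
      rw [trace_eq_sum e] at ht
      refine end_ext e fun i j => ?_
      rw [Fintype.sum_prod_type]
      simp only [E, Fin.sum_univ_three, LinearMap.add_apply, LinearMap.sub_apply,
        LinearMap.smul_apply, Module.End.mul_apply, LinearMap.smulRight_apply, map_add, map_sub,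
        map_smul, smul_eq_mul, coord_basis, Prod.swap]
      fin_cases i <;> fin_cases j <;> simp at ht ⊢ <;> first | ring1 | linear_combination -ht
    have hc : ∀ p, (slBracket (traceless (E p)) y).1 = E p * y.1 - y.1 * E p := fun p => by
      rw [coe_slBracket, coe_traceless, sub_mul, mul_sub, smul_mul_assoc, mul_smul_comm, one_mul,
        mul_one]
      abel
    simp only [LinearMap.comp_apply, Submodule.subtype_apply, hc, LinearMap.mulLeft_apply]
    rw [← map_sum, hy, map_smul, traceless_coe]
  -- With indices modulo 3, `E_{i,i+1} E_{i+1,i} = E_ii` sums to the identity, and only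
  -- off-diagonal, hence traceless, units occur.
  · refine eq_zero_of_rTensor_eq_zero (ι := Fin 3) (fun i => (unit e (i + 1) i (hne i)).1)
      (fun i => (unit e i (i + 1) (hne i).symm).1) one_ne_zero (fun u => ?_) _
      fun i => by simpa using congrArg (prB F V A B C S) (key (unit e (i + 1) i (hne i)))
    refine coord_ext e fun i => ?_
    fin_cases i <;> simp
  -- The action on `V*` carries a minus sign, whence the scalar `-1`.
  · refine eq_zero_of_rTensor_eq_zero (ι := Fin 3)
      (fun i => -slActDual.flip (unit e (i + 1) i (hne i)))
      (fun i => slActDual.flip (unit e i (i + 1) (hne i).symm))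
      (neg_ne_zero.2 one_ne_zero) (fun u => ?_) _
      fun i => by simpa using congrArg (prC F V A B C S) (key (unit e (i + 1) i (hne i)))
    refine e.ext fun i => ?_
    fin_cases i <;> simp [Fin.sum_univ_three, slActDual_apply]

/-! ### The conditions on `S` from the Jacobi identity -/

theorem cond0_of_jacobi (hvol : vol ≠ 0) (hc : D.SClosed)
    (hJ : ∀ x y z, jacobiator (D.bracket vol) x y z = 0) : D.Cond0 := by
  obtain ⟨e⟩ := exists_basis F V
  have hv := vol_basis_ne_zero vol e hvol
  -- `E₀₁ E₁₂ = E₀₂` and `E₁₂ E₀₁ = 0` isolate the product `ab`; the circle product and the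
  -- commutator are then recovered as its symmetric and skew parts.
  have hmul : ∀ d a b, D.sA d (D.mulA a b) = D.mulA (D.sA d a) b + D.mulA a (D.sA d b) :=
    fun d a b => by
      have h := hJ (inS F V A B C S d) (inA F V A B C S (unit e 0 1 (by decide) ⊗ₜ a))
        (inA F V A B C S (unit e 1 2 (by decide) ⊗ₜ b))
      rw [jacobiator_S_A_A D vol hc] at h
      have h := congrArg (coefA (entry e 0 2)) h
      simp [entry_traceless] at h
      linear_combination (norm := module) -h
  refine
    { closed := hc
      jacobi := fun d d' d'' => ?_
      moduleA := fun d d' a => ?_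
      moduleB := fun d d' b => ?_
      moduleC := fun d d' c => ?_
      inv_circ := fun d a b => ?_
      inv_comm := fun d a b => ?_
      inv_dA := fun d a b => ?_
      inv_actB := fun d a b => ?_
      inv_actC := fun d c a => ?_
      inv_t := fun d b c => ?_
      inv_dBC := fun d b c => ?_
      inv_crossB := fun d m n => ?_
      inv_crossC := fun d m n => ?_ }
  · have h := hJ (inS F V A B C S d) (inS F V A B C S d') (inS F V A B C S d'')
    rw [jacobiator_S_S_S D vol hc] at h
    exact congrArg (prS F V A B C S) h
  · have h := hJ (inS F V A B C S d) (inS F V A B C S d')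
      (inA F V A B C S (unit e 0 1 (by decide) ⊗ₜ a))
    rw [jacobiator_S_S_A D vol hc] at h
    have h := congrArg (coefA (entry e 0 1)) h
    simp [entry_unit] at h
    exact sub_eq_zero.1 h
  · have h := hJ (inS F V A B C S d) (inS F V A B C S d') (inB F V A B C S (e 0 ⊗ₜ b))
    rw [jacobiator_S_S_B D vol hc] at h
    have h := congrArg (coefB (e.coord 0)) h
    simp at h
    exact sub_eq_zero.1 h
  · have h := hJ (inS F V A B C S d) (inS F V A B C S d') (inC F V A B C S (e.coord 0 ⊗ₜ c))
    rw [jacobiator_S_S_C D vol hc] at h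
    have h := congrArg (coefC (Module.Dual.eval F V (e 0))) h
    simp at h
    exact sub_eq_zero.1 h
  · simp only [circ_eq, map_add, hmul]
    abel
  · simp only [comm_eq, map_sub, hmul]
    abel
  · have h := hJ (inS F V A B C S d) (inA F V A B C S (unit e 0 1 (by decide) ⊗ₜ a))
      (inA F V A B C S (unit e 1 0 (by decide) ⊗ₜ b))
    rw [jacobiator_S_A_A D vol hc] at h
    have h := congrArg (prS F V A B C S) h
    simp [slForm_eq_sum e, h3.out] at h
    exact (sub_eq_zero.1 h).symm
  · have h := hJ (inS F V A B C S d) (inA F V A B C S (unit e 0 1 (by decide) ⊗ₜ a))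
      (inB F V A B C S (e 1 ⊗ₜ b))
    rw [jacobiator_S_A_B] at h
    have h := congrArg (coefB (e.coord 0)) h
    simp at h
    exact (sub_eq_zero.1 h).symm
  · have h := hJ (inS F V A B C S d) (inA F V A B C S (unit e 0 1 (by decide) ⊗ₜ a))
      (inC F V A B C S (e.coord 0 ⊗ₜ c))
    rw [jacobiator_S_A_C] at h
    have h := congrArg (coefC (Module.Dual.eval F V (e 1))) h
    simp at h
    linear_combination (norm := module) h
  · have h := hJ (inS F V A B C S d) (inB F V A B C S (e 0 ⊗ₜ b))
      (inC F V A B C S (e.coord 1 ⊗ₜ c))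
    rw [jacobiator_S_B_C D vol hc] at h
    have h := congrArg (coefA (entry e 0 1)) h
    simp [entry_rankOne] at h
    exact (sub_eq_zero.1 h).symm
  · have h := hJ (inS F V A B C S d) (inB F V A B C S (e 0 ⊗ₜ b))
      (inC F V A B C S (e.coord 0 ⊗ₜ c))
    rw [jacobiator_S_B_C D vol hc] at h
    have h := congrArg (prS F V A B C S) h
    simp [h3.out] at h
    exact (sub_eq_zero.1 h).symm
  · have h := hJ (inS F V A B C S d) (inB F V A B C S (e 0 ⊗ₜ m)) (inB F V A B C S (e 1 ⊗ₜ n))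
    rw [jacobiator_S_B_B] at h
    have h := congrArg (coefC (Module.Dual.eval F V (e 2))) h
    simp [wedgeForm_apply, vol_apply e, hv] at h
    exact (sub_eq_zero.1 h).symm
  · have h := hJ (inS F V A B C S d) (inC F V A B C S (e.coord 0 ⊗ₜ m))
      (inC F V A B C S (e.coord 1 ⊗ₜ n))
    rw [jacobiator_S_C_C] at h
    have h := congrArg (coefB (e.coord 2)) h
    simp only [coefB_inB, apply_wedgeDual, dualForm_apply e hvol] at h
    simp [hv] at h
    exact (sub_eq_zero.1 h).symm

end BracketData
end SlThree

theorem theorem1 {F V A B C S : Type*} [Field F] [NeZero (2 : F)] [NeZero (3 : F)]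
    [AddCommGroup V] [Module F V] [Fact (Module.finrank F V = 3)]
    [AddCommGroup A] [Module F A] [AddCommGroup B] [Module F B]
    [AddCommGroup C] [Module F C] [AddCommGroup S] [Module F S]
    (vol : V [⋀^Fin 3]→ₗ[F] F) (hvol : vol ≠ 0)
    (D : SlThree.BracketData F V A B C S)
    (hS : D.SClosed ∨ ∃ e : A, D.IsDistinguished e) :
    SlThree.IsLieBracket (D.bracket vol) ↔
      D.Cond0 ∧ D.Cond1 ∧ D.Cond2 ∧ D.Cond3 ∧ D.Cond4 ∧ D.Cond5 ∧ D.Cond6 := by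
  refine ⟨fun h => ?_, fun ⟨h0, h1, h2, h3, h4, h5, h6⟩ =>
    SlThree.BracketData.isLieBracket_of_conds vol hvol h0 h1 h2 h3 h4 h5 h6⟩
  have hJ : ∀ x y z, SlThree.jacobiator (D.bracket vol) x y z = 0 := h.jacobi
  -- Closure must come first: the brackets `[d, d']` inside the Jacobi sums reduce to `brS` only
  -- once they lie in `S`.
  have hc : D.SClosed := hS.elim id fun ⟨_, he⟩ => he.sClosed hJ
  open SlThree.BracketData in
  exact ⟨cond0_of_jacobi hvol hc hJ, cond1_of_jacobi hJ, cond2_of_jacobi hJ, cond3_of_jacobi hJ,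
    cond4_of_jacobi hvol hJ, cond5_of_jacobi hvol hJ, cond6_of_jacobi hvol hJ⟩
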